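/- Let $T>0$ and let $B=C_0([0,T]\to\mathbb{C})$ be the space of continuous paths $\omega:[0,T]\to\mathbb{C}$ with $\omega(0)=0$, with the supremum norm and its Borel $\sigma$-field. Let $\mu$ be the Wiener measure on $B$, i.e. the law of a planar standard Brownian motion $B^1+iB^2$ on $[0,T]$ ($B^1,B^2$ independent real standard Brownian motions). Let $\theta\in(-\frac{\pi}{2},\frac{\pi}{2})$ and, for $t\ge 0$, let $$T_tF(x)=\int_B F\bigl(e^{-(\cos\theta+i\sin\theta)t}x+\sqrt{1-e^{-2t\cos\theta}}\,y\bigr)\,\mu(dy)$$ be the nonsymmetric Ornstein–Uhlenbeck semigroup. For fixed $t\ge 0$ and $p>1$ set $$q(t)=e^{2t\cos\theta}(p-1)+1 .$$ Then for every complex-valued $F\in L^p(B,\mu)$ the integral defining $T_tF(x)$ converges absolutely for $\mu$-almost every $x$, $T_tF\in L^{q(t)}(B,\mu)$, and $$\|T_tF\|_{L^{q(t)}(B,\mu)}\le\|F\|_{L^p(B,\mu)} .$$ -/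

import Mathlib

open MeasureTheory ProbabilityTheory

noncomputable section

/-- The subspace `C₀([0,T] → ℂ)` of the continuous paths that vanish at time `0`. -/
def pathSubmodule (T : ℝ) : Submodule ℂ C(Set.Icc (0 : ℝ) T, ℂ) where
  carrier := {ω | ∀ s : Set.Icc (0 : ℝ) T, (s : ℝ) = 0 → ω s = 0}
  zero_mem' := fun _ _ => rfl
  add_mem' := fun {a b} ha hb s hs => by simp [ha s hs, hb s hs]
  smul_mem' := fun c a ha s hs => by simp [ha s hs]

/-- The complex path space `B = C₀([0,T] → ℂ)`, a complex normed space under the supremum norm. -/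
abbrev PathSpace (T : ℝ) : Type := ↥(pathSubmodule T)

/-- The Borel σ-field generated by the open sets of the supremum norm. -/
instance instMeasurableSpacePathSpace (T : ℝ) : MeasurableSpace (PathSpace T) := borel _

instance instBorelSpacePathSpace (T : ℝ) : BorelSpace (PathSpace T) := ⟨rfl⟩

/-- `μ` is the Wiener measure on `C₀([0,T] → ℂ)`: under `μ`, the coordinate process
`s ↦ ω s = ω¹ s + i ω² s` is a planar standard Brownian motion, that is, a centered Gaussian process
in `ℂ = ℝ²` such that `ω¹` and `ω²` are uncorrelated, each with covariance function `min s t`.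
(Being a probability measure is part of `IsGaussianProcess`.) -/
structure IsComplexWienerMeasure (T : ℝ) (μ : Measure (PathSpace T)) : Prop where
  isGaussianProcess :
    IsGaussianProcess (fun (s : Set.Icc (0 : ℝ) T) (ω : PathSpace T) => ω.1 s) μ
  mean_eq_zero : ∀ s : Set.Icc (0 : ℝ) T, ∫ ω, ω.1 s ∂μ = 0
  cov_re_re : ∀ s t : Set.Icc (0 : ℝ) T,
    cov[fun ω => (ω.1 s).re, fun ω => (ω.1 t).re; μ] = min (s : ℝ) (t : ℝ)
  cov_im_im : ∀ s t : Set.Icc (0 : ℝ) T,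
    cov[fun ω => (ω.1 s).im, fun ω => (ω.1 t).im; μ] = min (s : ℝ) (t : ℝ)
  cov_re_im : ∀ s t : Set.Icc (0 : ℝ) T,
    cov[fun ω => (ω.1 s).re, fun ω => (ω.1 t).im; μ] = 0

/-- The point `e^{-(cos θ + i sin θ) t} x + √(1 - e^{-2 t cos θ}) y` of the path space. -/
def ouPoint {T : ℝ} (θ t : ℝ) (x y : PathSpace T) : PathSpace T :=
  Complex.exp (-((Real.cos θ : ℂ) + Complex.I * (Real.sin θ : ℂ)) * (t : ℂ)) • x
    + Real.sqrt (1 - Real.exp (-2 * t * Real.cos θ)) • y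

/-- The nonsymmetric Ornstein–Uhlenbeck semigroup
`T_t F (x) = ∫ F (e^{-(cos θ + i sin θ) t} x + √(1 - e^{-2 t cos θ}) y) μ(dy)`. -/
def ouSemigroup {T : ℝ} (μ : Measure (PathSpace T)) (θ t : ℝ) (F : PathSpace T → ℂ)
    (x : PathSpace T) : ℂ :=
  ∫ y, F (ouPoint θ t x y) ∂μ

end

/-! Put `ρ = exp (-(t cos θ))`, `σ = √(1 - ρ²)` and `c = exp (-i t sin θ)`. The nonsymmetric
operator is the symmetric one, `F ↦ ∫ F (ρ x + σ y) μ(dy)`, evaluated at `c x`. Planar Brownian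
motion is invariant under multiplication by the unit complex number `c`, so the rotation changes
neither null sets nor norms. What remains is Nelson's hypercontractivity, at the critical exponent
`ρ² (q - 1) = p - 1`.

By duality, Nelson's theorem follows from a two-function inequality: if `X` and `Y = ρ X + σ X'` are
correlated copies of a centered Gaussian, then `E[f(X)^α g(Y)^β] ≤ (E f)^α (E g)^β` for nonnegative
`f`, `g`, provided `ρ² α β ≤ (1 - α) (1 - β)`. The choice `α = 1 - 1/q`, `β = 1/p` turns the proviso
into `ρ² (q - 1) ≤ p - 1`.

The two-function inequality is proved by a heat flow in discrete time. Averaging `f^α g^β` over a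
correlated Gaussian step of variance `τ` gives at most `(P_τ f)^α (P_τ g)^β + O(τ^(3/2))`: the
linear Taylor terms have mean zero, and the quadratic ones have mean at most zero by a discriminant
computation, which is where the proviso enters (`correlated_quadratic_nonpos`,
`exists_gaussHeat_corrPair_le`). Since `P_τ` preserves the regularity class of `f` and `g`, `n`
steps of size `1/n` accumulate an error `O(n^(-1/2))`, which vanishes in the limit. No generator or
second derivative is needed.

Mollification gives bounded continuous functions in finite dimension; Bernstein polynomials, which
depend on finitely many values of a path, carry the inequality to the path space; density and
Fatou's lemma give all of `L^p`. -/

/-! ### Second-order expansion of `(1 + a)^α (1 + b)^β` -/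

lemma exists_abs_sub_le_cube_of_hasDerivAt {s : Set ℝ} (hs : Convex ℝ s) (h0 : (0 : ℝ) ∈ s)
    {f₀ f₁ f₂ f₃ : ℝ → ℝ} {K : ℝ}
    (h1 : ∀ x ∈ s, HasDerivAt f₀ (f₁ x) x) (h2 : ∀ x ∈ s, HasDerivAt f₁ (f₂ x) x)
    (h3 : ∀ x ∈ s, HasDerivAt f₂ (f₃ x) x) (hK : ∀ x ∈ s, |f₃ x| ≤ K)
    (z0 : f₀ 0 = 0) (z1 : f₁ 0 = 0) (z2 : f₂ 0 = 0) :
    ∀ x ∈ s, |f₀ x| ≤ K * |x| ^ 3 := by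
  have hK0 : 0 ≤ K := (abs_nonneg _).trans (hK 0 h0)
  -- The mean value inequality on the segment from `0` to `x` gains one power of `|x|`; three
  -- applications give the cube, and no factor `1/6` is sought.
  have key : ∀ {u v : ℝ → ℝ} {n : ℕ}, (∀ x ∈ s, HasDerivAt u (v x) x) →
      (∀ x ∈ s, |v x| ≤ K * |x| ^ n) → u 0 = 0 → ∀ x ∈ s, |u x| ≤ K * |x| ^ (n + 1) := by
    intro u v n hd hb hz x hx
    have hseg : segment ℝ 0 x ⊆ s := hs.segment_subset h0 hx
    have := (convex_segment (𝕜 := ℝ) 0 x).norm_image_sub_le_of_norm_hasDerivWithin_le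
      (f := u) (f' := v) (C := K * |x| ^ n)
      (fun y hy => (hd y (hseg hy)).hasDerivWithinAt) (fun y hy => ?_)
      (left_mem_segment ℝ 0 x) (right_mem_segment ℝ 0 x)
    · simpa [hz, pow_succ, mul_assoc] using this
    · refine (hb y (hseg hy)).trans ?_
      have : |y| ≤ |x| := by
        simpa using norm_sub_le_of_mem_segment hy
      gcongr
  exact key h1 (key h2 (key (n := 0) h3 (by simpa using hK) z2) z1) z0

/-- The interval is compact and stays away from the singularity `w = -1`, so the third derivative of
`(1 + w)^α` is bounded there. -/
lemma exists_abs_one_add_rpow_sub_le (α δ M : ℝ) (hδ : 0 < δ) (hδ1 : δ ≤ 1) (hM : 0 ≤ M) :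
    ∃ K, 0 ≤ K ∧ ∀ w ∈ Set.Icc (-1 + δ) M,
      |(1 + w) ^ α - (1 + α * w - α * (1 - α) / 2 * w ^ 2)| ≤ K * |w| ^ 3 := by
  have hpos : ∀ w ∈ Set.Icc (-1 + δ) M, 0 < 1 + w := fun w hw => by linarith [hw.1]
  have hcont : ContinuousOn (fun w : ℝ => α * (α - 1) * (α - 2) * (1 + w) ^ (α - 3))
      (Set.Icc (-1 + δ) M) := by
    refine continuousOn_const.mul (ContinuousOn.rpow_const (by fun_prop) fun w hw => ?_)
    exact Or.inl (hpos w hw).ne'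
  obtain ⟨K, hK⟩ := isCompact_Icc.exists_bound_of_continuousOn hcont
  have h0 : (0 : ℝ) ∈ Set.Icc (-1 + δ) M := ⟨by linarith, hM⟩
  have hd : ∀ (γ : ℝ), ∀ w ∈ Set.Icc (-1 + δ) M,
      HasDerivAt (fun w : ℝ => (1 + w) ^ γ) (γ * (1 + w) ^ (γ - 1)) w := by
    intro γ w hw
    have := ((hasDerivAt_id w).const_add 1).rpow_const (p := γ) (Or.inl (hpos w hw).ne')
    simpa using this
  refine ⟨K, (norm_nonneg _).trans (hK 0 h0), ?_⟩
  refine exists_abs_sub_le_cube_of_hasDerivAt (convex_Icc _ _) h0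
    (f₁ := fun w => α * (1 + w) ^ (α - 1) - (α - α * (1 - α) * w))
    (f₂ := fun w => α * (α - 1) * (1 + w) ^ (α - 2) - α * (α - 1))
    (f₃ := fun w => α * (α - 1) * (α - 2) * (1 + w) ^ (α - 3)) ?_ ?_ ?_ hK ?_ ?_ ?_
  · intro w hw
    have h1 := (((hasDerivAt_id w).const_mul α).const_add 1).sub
      ((hasDerivAt_pow 2 w).const_mul (α * (1 - α) / 2))
    convert! (hd α w hw).sub h1 using 1
    simp; ring
  · intro w hw
    have h1 := ((hasDerivAt_id w).const_mul (α * (1 - α))).const_sub α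
    convert! ((hd (α - 1) w hw).const_mul α).sub h1 using 1
    rw [show α - 1 - 1 = α - 2 by ring]; simp; ring
  · intro w hw
    convert! ((hd (α - 2) w hw).const_mul (α * (α - 1))).sub_const (α * (α - 1)) using 1
    rw [show α - 2 - 1 = α - 3 by ring]; ring
  · simp
  · simp
  · simp

lemma exists_one_add_rpow_mul_le (α β δ M : ℝ) (hα : α ∈ Set.Ioo (0 : ℝ) 1)
    (hβ : β ∈ Set.Ioo (0 : ℝ) 1) (hδ : 0 < δ) (hδ1 : δ ≤ 1) (hM : 0 ≤ M) :
    ∃ K, 0 ≤ K ∧ ∀ a ∈ Set.Icc (-1 + δ) M, ∀ b ∈ Set.Icc (-1 + δ) M,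
      (1 + a) ^ α * (1 + b) ^ β ≤ 1 + α * a + β * b
        + (α * β * (a * b) - α * (1 - α) / 2 * a ^ 2 - β * (1 - β) / 2 * b ^ 2)
        + K * (|a| + |b|) ^ 3 := by
  obtain ⟨K₁, hK₁, h₁⟩ := exists_abs_one_add_rpow_sub_le α δ M hδ hδ1 hM
  obtain ⟨K₂, hK₂, h₂⟩ := exists_abs_one_add_rpow_sub_le β δ M hδ hδ1 hM
  obtain ⟨hα0, hα1⟩ := hα
  obtain ⟨hβ0, hβ1⟩ := hβ
  set N := max M 1 with hN
  have hN1 : 1 ≤ N := le_max_right _ _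
  -- With `A`, `B` the two powers and `PA`, `PB` their Taylor polynomials, the three summands bound
  -- `(A - PA) PB`, `A (B - PB)` and the terms of degree at least three in `PA PB`.
  refine ⟨K₁ * (1 + N + N ^ 2) + K₂ * (1 + N) + (2 + N), by positivity, fun a ha b hb => ?_⟩
  have haN : |a| ≤ N := abs_le.2 ⟨by linarith [ha.1], ha.2.trans (le_max_left _ _)⟩
  have hbN : |b| ≤ N := abs_le.2 ⟨by linarith [hb.1], hb.2.trans (le_max_left _ _)⟩
  have ha' := h₁ a ha
  have hb' := h₂ b hb
  set A := (1 + a) ^ α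
  set B := (1 + b) ^ β
  set κ := α * (1 - α) / 2 with hκ
  set κ' := β * (1 - β) / 2 with hκ'
  have hκ0 : 0 ≤ κ := by have := sub_nonneg.2 hα1.le; positivity
  have hκ'0 : 0 ≤ κ' := by have := sub_nonneg.2 hβ1.le; positivity
  have hκ1 : κ ≤ 1 := by rw [hκ]; nlinarith
  have hκ'1 : κ' ≤ 1 := by rw [hκ']; nlinarith
  set PA := 1 + α * a - κ * a ^ 2 with hPA
  set PB := 1 + β * b - κ' * b ^ 2 with hPB
  have hPBb : |PB| ≤ 1 + N + N ^ 2 := by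
    rw [hPB]
    calc |1 + β * b - κ' * b ^ 2| ≤ |1| + |β * b| + |κ' * b ^ 2| :=
          (abs_sub _ _).trans (by gcongr; exact abs_add_le _ _)
      _ = 1 + β * |b| + κ' * |b| ^ 2 := by
          rw [abs_mul, abs_mul, abs_pow, abs_of_pos hβ0, abs_of_nonneg hκ'0, abs_one]
      _ ≤ 1 + 1 * N + 1 * N ^ 2 := by gcongr
      _ = _ := by ring
  have hAb : |A| ≤ 1 + N := by
    have h1 : 0 ≤ 1 + a := by linarith [ha.1]
    have : A ≤ (1 + N) ^ α := Real.rpow_le_rpow h1 (by linarith [(abs_le.1 haN).2]) hα0.le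
    rw [abs_of_nonneg (Real.rpow_nonneg h1 _)]
    refine this.trans ?_
    exact (Real.rpow_le_rpow_of_exponent_le (by linarith) hα1.le).trans (Real.rpow_one _).le
  have e1 : A * B = PA * PB + (A - PA) * PB + A * (B - PB) := by ring
  have b1 : (A - PA) * PB ≤ K₁ * |a| ^ 3 * (1 + N + N ^ 2) := by
    refine (le_abs_self _).trans ?_
    rw [abs_mul]; gcongr
  have b2 : A * (B - PB) ≤ (1 + N) * (K₂ * |b| ^ 3) := by
    refine (le_abs_self _).trans ?_
    rw [abs_mul]; gcongr
  have e2 : PA * PB = 1 + α * a + β * b + (α * β * (a * b) - κ * a ^ 2 - κ' * b ^ 2)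
      + (-(α * κ') * (a * b ^ 2) - (κ * β) * (a ^ 2 * b) + (κ * κ') * (a ^ 2 * b ^ 2)) := by
    rw [hPA, hPB]; ring
  have hab : ∀ i j : ℕ, i + j = 3 → |a| ^ i * |b| ^ j ≤ (|a| + |b|) ^ 3 := by
    intro i j hij
    rw [← hij, pow_add]
    gcongr <;> linarith [abs_nonneg a, abs_nonneg b]
  have b3 : -(α * κ') * (a * b ^ 2) - (κ * β) * (a ^ 2 * b) + (κ * κ') * (a ^ 2 * b ^ 2)
      ≤ (2 + N) * (|a| + |b|) ^ 3 := by
    have t1 : -(α * κ') * (a * b ^ 2) ≤ 1 * 1 * (|a| ^ 1 * |b| ^ 2) := by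
      refine (le_abs_self _).trans ?_
      rw [abs_mul, abs_neg, abs_mul, abs_mul, abs_pow, abs_of_pos hα0, abs_of_nonneg hκ'0, pow_one]
      gcongr
    have t2 : -(κ * β) * (a ^ 2 * b) ≤ 1 * 1 * (|a| ^ 2 * |b| ^ 1) := by
      refine (le_abs_self _).trans ?_
      rw [abs_mul, abs_neg, abs_mul, abs_mul, abs_pow, abs_of_pos hβ0, abs_of_nonneg hκ0, pow_one]
      gcongr
    have t3 : (κ * κ') * (a ^ 2 * b ^ 2) ≤ 1 * 1 * ((|a| ^ 1 * |b| ^ 2) * N) := by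
      refine (le_abs_self _).trans ?_
      rw [abs_mul, abs_mul, abs_mul, abs_pow, abs_pow, abs_of_nonneg hκ0, abs_of_nonneg hκ'0]
      rw [show |a| ^ 1 * |b| ^ 2 * N = (|a| * N) * |b| ^ 2 by ring, pow_two |a|]
      gcongr
    have := hab 1 2 rfl
    have := hab 2 1 rfl
    nlinarith
  have := hab 3 0 rfl
  have := hab 0 3 rfl
  rw [e1, e2]
  have c1 : K₁ * |a| ^ 3 * (1 + N + N ^ 2) ≤ K₁ * (1 + N + N ^ 2) * (|a| + |b|) ^ 3 := by
    rw [mul_right_comm]; gcongr; linarith [abs_nonneg b]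
  have c2 : (1 + N) * (K₂ * |b| ^ 3) ≤ K₂ * (1 + N) * (|a| + |b|) ^ 3 := by
    rw [← mul_assoc, mul_comm (1 + N)]; gcongr; linarith [abs_nonneg a]
  linarith

/-- The second-order expansion when the increments are linear up to a quadratic remainder. -/
lemma exists_one_add_rpow_mul_le_of_approx (α β δ M L : ℝ) (hα : α ∈ Set.Ioo (0 : ℝ) 1)
    (hβ : β ∈ Set.Ioo (0 : ℝ) 1) (hδ : 0 < δ) (hδ1 : δ ≤ 1) (hM : 0 ≤ M) (hL : 0 ≤ L) :
    ∃ K, 0 ≤ K ∧ ∀ a ∈ Set.Icc (-1 + δ) M, ∀ b ∈ Set.Icc (-1 + δ) M, ∀ h ∈ Set.Icc (0 : ℝ) 1,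
      ∀ l m N : ℝ, 1 ≤ N → |l| ≤ L * N → |m| ≤ L * N → |a - h * l| ≤ L * h ^ 2 * N ^ 2 →
      |b - h * m| ≤ L * h ^ 2 * N ^ 2 →
      (1 + a) ^ α * (1 + b) ^ β ≤ 1 + α * a + β * b
        + h ^ 2 * (α * β * (l * m) - α * (1 - α) / 2 * l ^ 2 - β * (1 - β) / 2 * m ^ 2)
        + K * h ^ 3 * N ^ 6 := by
  obtain ⟨K, hK, H⟩ := exists_one_add_rpow_mul_le α β δ M hα hβ hδ hδ1 hM
  obtain ⟨hα0, hα1⟩ := hα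
  obtain ⟨hβ0, hβ1⟩ := hβ
  -- Replacing `ab`, `a²`, `b²` by `h²lm`, `h²l²`, `h²m²` costs `3 L² h³ N⁶` each, with coefficients
  -- at most one in absolute value; the cubic remainder costs `K (4 h L N²)³`.
  refine ⟨9 * L ^ 2 + 64 * K * L ^ 3, by positivity, fun a ha b hb h hh l m N hN hl hm hr hs => ?_⟩
  obtain ⟨hh0, hh1⟩ := hh
  have hq : ∀ x y l' m' : ℝ, |l'| ≤ L * N → |m'| ≤ L * N → |x - h * l'| ≤ L * h ^ 2 * N ^ 2 →
      |y - h * m'| ≤ L * h ^ 2 * N ^ 2 → |x * y - h ^ 2 * (l' * m')| ≤ 3 * L ^ 2 * h ^ 3 * N ^ 6 := by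
    intro x y l' m' hl hm hx hy
    have e : x * y - h ^ 2 * (l' * m') = (x - h * l') * (y - h * m') + (x - h * l') * (h * m')
      + (h * l') * (y - h * m') := by ring
    rw [e]
    calc _ ≤ |x - h * l'| * |y - h * m'| + |x - h * l'| * (h * |m'|) + h * |l'| * |y - h * m'| := by
          refine (abs_add_le _ _).trans ?_
          refine (add_le_add (abs_add_le _ _) le_rfl).trans ?_
          rw [abs_mul, abs_mul, abs_mul, abs_mul, abs_mul, abs_of_nonneg hh0]
      _ ≤ (L * h ^ 2 * N ^ 2) * (L * h ^ 2 * N ^ 2) + (L * h ^ 2 * N ^ 2) * (h * (L * N))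
          + h * (L * N) * (L * h ^ 2 * N ^ 2) := by gcongr
      _ = L ^ 2 * h ^ 3 * (h * N ^ 4 + N ^ 3 + N ^ 3) := by ring
      _ ≤ L ^ 2 * h ^ 3 * (1 * N ^ 6 + N ^ 6 + N ^ 6) := by
          gcongr <;> first | exact hN | norm_num
      _ = _ := by ring
  have hA : ∀ x l' : ℝ, |l'| ≤ L * N → |x - h * l'| ≤ L * h ^ 2 * N ^ 2 →
      |x| ≤ 2 * h * L * N ^ 2 := by
    intro x l' hl hx
    calc |x| = |(x - h * l') + h * l'| := by ring_nf
      _ ≤ |x - h * l'| + h * |l'| := by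
          refine (abs_add_le _ _).trans ?_
          rw [abs_mul h, abs_of_nonneg hh0]
      _ ≤ L * h ^ 2 * N ^ 2 + h * (L * N) := by gcongr
      _ = h * L * (h * N ^ 2 + N ^ 1) := by ring
      _ ≤ h * L * (1 * N ^ 2 + N ^ 2) := by
          gcongr <;> first | exact hN | norm_num
      _ = _ := by ring
  have h1 := H a ha b hb
  have qab := abs_le.1 (hq a b l m hl hm hr hs)
  have qaa := abs_le.1 (hq a a l l hl hl hr hr)
  have qbb := abs_le.1 (hq b b m m hm hm hs hs)
  have hc : (|a| + |b|) ^ 3 ≤ 64 * L ^ 3 * (h ^ 3 * N ^ 6) := by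
    calc (|a| + |b|) ^ 3 ≤ (2 * h * L * N ^ 2 + 2 * h * L * N ^ 2) ^ 3 := by
          gcongr
          · exact hA a l hl hr
          · exact hA b m hm hs
      _ = _ := by ring
  have hc' := mul_le_mul_of_nonneg_left hc hK
  have hX : 0 ≤ 3 * L ^ 2 * h ^ 3 * N ^ 6 := by positivity
  have hc1 : α * β * (a * b - h ^ 2 * (l * m)) ≤ 1 * (3 * L ^ 2 * h ^ 3 * N ^ 6) := by
    have : α * β ≤ 1 := by nlinarith
    exact (mul_le_mul_of_nonneg_left qab.2 (by positivity)).trans (by gcongr)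
  have hc2 : ∀ γ : ℝ, 0 < γ → γ < 1 → ∀ X Y : ℝ, -Y ≤ X → 0 ≤ Y →
      -(γ * (1 - γ) / 2 * X) ≤ 1 * Y := by
    intro γ h0 h1 X Y hXY hY
    have k0 : 0 ≤ γ * (1 - γ) / 2 := by have := sub_nonneg.2 h1.le; positivity
    have k1 : γ * (1 - γ) / 2 ≤ 1 := by nlinarith
    calc -(γ * (1 - γ) / 2 * X) = γ * (1 - γ) / 2 * (-X) := by ring
      _ ≤ γ * (1 - γ) / 2 * Y := by gcongr; linarith
      _ ≤ _ := by gcongr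
  have hc3 := hc2 α hα0 hα1 _ _ qaa.1 hX
  have hc4 := hc2 β hβ0 hβ1 _ _ qbb.1 hX
  linarith

/-- The hypothesis on `ρ` says that the discriminant of this quadratic form in `(l, m)` is not
positive, while its diagonal coefficients are negative. -/
lemma correlated_quadratic_nonpos {α β ρ : ℝ} (hα : α ∈ Set.Ioo (0 : ℝ) 1)
    (hβ : β ∈ Set.Ioo (0 : ℝ) 1) (hρ : ρ ^ 2 * (α * β) ≤ (1 - α) * (1 - β)) (l m : ℝ) :
    α * β * (ρ * (l * m)) - α * (1 - α) / 2 * l ^ 2 - β * (1 - β) / 2 * m ^ 2 ≤ 0 := by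
  obtain ⟨hα0, hα1⟩ := hα
  obtain ⟨hβ0, hβ1⟩ := hβ
  have h1 : 0 < α * (1 - α) := mul_pos hα0 (sub_pos.2 hα1)
  -- Completing the square in `l`, after multiplication by the positive number `α (1 - α)`.
  have h2 := sq_nonneg (α * (1 - α) * l - α * β * ρ * m)
  have h3 : (α * β * ρ) ^ 2 ≤ α * (1 - α) * (β * (1 - β)) := by
    have := mul_le_mul_of_nonneg_left hρ (mul_pos hα0 hβ0).le
    nlinarith
  have h4 := mul_le_mul_of_nonneg_right h3 (sq_nonneg m)
  by_contra! hcon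
  have := mul_pos h1 hcon
  nlinarith

lemma Continuous.integrable_of_bounded' {X : Type*} [TopologicalSpace X] [MeasurableSpace X]
    [OpensMeasurableSpace X] {ν : Measure X} [IsFiniteMeasure ν] {f : X → ℝ}
    (hf : Continuous f) {C : ℝ} (hC : ∀ x, |f x| ≤ C) : Integrable f ν :=
  Integrable.of_bound hf.aestronglyMeasurable C (Filter.Eventually.of_forall hC)

/-! ### Functions with a bounded Lipschitz derivative -/

section IsSmoothBetween

variable {E : Type*} [NormedAddCommGroup E] [NormedSpace ℝ E]

/-- `f` takes values in `[c, C]` and has a bounded Lipschitz derivative. -/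
structure IsSmoothBetween (c C L : ℝ) (f : E → ℝ) : Prop where
  differentiable : Differentiable ℝ f
  ge : ∀ x, c ≤ f x
  le : ∀ x, f x ≤ C
  norm_fderiv_le : ∀ x, ‖fderiv ℝ f x‖ ≤ L
  norm_fderiv_sub_le : ∀ x y, ‖fderiv ℝ f x - fderiv ℝ f y‖ ≤ L * ‖x - y‖

namespace IsSmoothBetween

variable {c C L : ℝ} {f : E → ℝ}

lemma L_nonneg (hf : IsSmoothBetween c C L f) : 0 ≤ L :=
  (norm_nonneg _).trans (hf.norm_fderiv_le 0)

lemma continuous (hf : IsSmoothBetween c C L f) : Continuous f := hf.differentiable.continuous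

lemma abs_le_max (hf : IsSmoothBetween c C L f) (x : E) : |f x| ≤ max C (-c) :=
  abs_le'.2 ⟨(hf.le x).trans (le_max_left _ _), (neg_le_neg (hf.ge x)).trans (le_max_right _ _)⟩

lemma continuous_fderiv (hf : IsSmoothBetween c C L f) : Continuous (fderiv ℝ f) :=
  (LipschitzWith.of_dist_le_mul (K := ⟨L, hf.L_nonneg⟩) fun x y => by
    rw [dist_eq_norm, dist_eq_norm]; exact hf.norm_fderiv_sub_le x y).continuous

lemma abs_sub_fderiv_le (hf : IsSmoothBetween c C L f) (x z : E) :
    |f (x + z) - f x - fderiv ℝ f x z| ≤ L * ‖z‖ ^ 2 := by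
  have := (convex_segment (𝕜 := ℝ) x (x + z)).norm_image_sub_le_of_norm_fderiv_le' (𝕜 := ℝ)
    (f := f) (φ := fderiv ℝ f x) (C := L * ‖z‖)
    (fun y _ => hf.differentiable y) (fun y hy => ?_) (left_mem_segment ℝ _ _)
    (right_mem_segment ℝ _ _)
  · simpa [pow_two, mul_assoc] using this
  · refine (hf.norm_fderiv_sub_le y x).trans ?_
    have := norm_sub_le_of_mem_segment hy
    have hL := hf.L_nonneg
    gcongr
    simpa using this

end IsSmoothBetween

end IsSmoothBetween

/-! ### The heat semigroup of a Gaussian measure -/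

section GaussHeat

variable {E : Type*} [NormedAddCommGroup E] [NormedSpace ℝ E] [MeasurableSpace E] [BorelSpace E]
  [SecondCountableTopology E] [CompleteSpace E] {μ : Measure E} [IsGaussian μ]

/-- The product of two copies of a centered Gaussian measure is invariant under rotations of the
pair; with `a = cos φ` and `b = sin φ`, this is the first marginal of the rotated pair. -/
lemma ProbabilityTheory.IsGaussian.map_smul_add_smul (hμ : ∫ x, x ∂μ = 0) {a b : ℝ}
    (hab : a ^ 2 + b ^ 2 = 1) : (μ.prod μ).map (fun z : E × E => a • z.1 + b • z.2) = μ := by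
  have hn : ‖(⟨a, b⟩ : ℂ)‖ = 1 := by
    rw [Complex.norm_def, Complex.normSq_mk, ← pow_two, ← pow_two, hab, Real.sqrt_one]
  have hne : (⟨a, b⟩ : ℂ) ≠ 0 := by
    intro h; rw [h] at hn; simp at hn
  have hc : Real.cos (Complex.arg ⟨a, b⟩) = a := by rw [Complex.cos_arg hne, hn, div_one]
  have hs : Real.sin (Complex.arg ⟨a, b⟩) = b := by rw [Complex.sin_arg, hn, div_one]
  have h := IsGaussian.map_rotation_eq_self (μ := μ) (by simpa using hμ) (Complex.arg ⟨a, b⟩)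
  have h2 := congrArg (fun ν => ν.map Prod.fst) h
  rw [Measure.map_map (by fun_prop) (by fun_prop), Measure.map_fst_prod] at h2
  simpa [Function.comp_def, ContinuousLinearMap.rotation_apply, hc, hs] using h2

/-- The heat semigroup of a Gaussian measure: `f` averaged over `x + √τ y` with `y` of law `μ`. -/
noncomputable def gaussHeat (μ : Measure E) (τ : ℝ) (f : E → ℝ) (x : E) : ℝ :=
  ∫ y, f (x + √τ • y) ∂μ

omit [SecondCountableTopology E] [CompleteSpace E] [BorelSpace E] in
@[simp]
lemma gaussHeat_zero (f : E → ℝ) : gaussHeat μ 0 f = f := by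
  ext x; simp [gaussHeat]

omit [SecondCountableTopology E] [CompleteSpace E] in
lemma continuous_gaussHeat {f : E → ℝ} (hf : Continuous f) {C : ℝ} (hC : ∀ x, |f x| ≤ C) (τ : ℝ) :
    Continuous (gaussHeat μ τ f) := by
  refine continuous_of_dominated (bound := fun _ => C) (fun x => ?_) (fun x => ?_)
    (integrable_const C) ?_
  · exact Continuous.aestronglyMeasurable (by fun_prop)
  · exact Filter.Eventually.of_forall fun y => hC _
  · exact Filter.Eventually.of_forall fun y => by fun_prop

omit [SecondCountableTopology E] [CompleteSpace E] [BorelSpace E] in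
lemma abs_gaussHeat_le {f : E → ℝ} {C : ℝ} (hC : ∀ x, |f x| ≤ C) (τ : ℝ) (x : E) :
    |gaussHeat μ τ f x| ≤ C := by
  have := norm_integral_le_of_norm_le_const (μ := μ) (f := fun y => f (x + √τ • y)) (C := C)
    (Filter.Eventually.of_forall fun y => hC _)
  simpa [gaussHeat] using this

/-- For independent `y`, `y'` of law `μ`, the sum `√τ y + √σ y'` has the law of `√(τ + σ) y`, by
rotation invariance with the normalised coefficients `√τ / √(τ + σ)` and `√σ / √(τ + σ)`. -/
lemma gaussHeat_gaussHeat (hμ : ∫ x, x ∂μ = 0) {f : E → ℝ} (hf : Continuous f) {C : ℝ}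
    (hC : ∀ x, |f x| ≤ C) {τ σ : ℝ} (hτ : 0 ≤ τ) (hσ : 0 ≤ σ) :
    gaussHeat μ τ (gaussHeat μ σ f) = gaussHeat μ (τ + σ) f := by
  ext x
  rcases (add_nonneg hτ hσ).eq_or_lt with h0 | h0
  · have h1 : τ = 0 := by linarith
    have h2 : σ = 0 := by linarith
    simp [h1, h2]
  have hab : (√τ / √(τ + σ)) ^ 2 + (√σ / √(τ + σ)) ^ 2 = 1 := by
    rw [div_pow, div_pow, Real.sq_sqrt hτ, Real.sq_sqrt hσ, Real.sq_sqrt h0.le]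
    field_simp
  have hs : √(τ + σ) ≠ 0 := (Real.sqrt_pos.2 h0).ne'
  have key : gaussHeat μ (τ + σ) f x = ∫ z, f (x + √τ • z.1 + √σ • z.2) ∂(μ.prod μ) := by
    rw [gaussHeat]
    conv_lhs => rw [← IsGaussian.map_smul_add_smul hμ hab]
    rw [integral_map (by fun_prop) (Continuous.aestronglyMeasurable (by fun_prop))]
    congr 1 with z
    rw [smul_add, smul_smul, smul_smul, mul_div_cancel₀ _ hs, mul_div_cancel₀ _ hs, add_assoc]
  rw [key, integral_prod]
  · rfl
  · exact Continuous.integrable_of_bounded' (by fun_prop) (C := C) fun z => hC _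

namespace IsSmoothBetween

variable {c C L : ℝ} {f : E → ℝ}

omit [CompleteSpace E] in
lemma hasFDerivAt_gaussHeat (hf : IsSmoothBetween c C L f) (τ : ℝ) (x : E) :
    HasFDerivAt (gaussHeat μ τ f) (∫ y, fderiv ℝ f (x + √τ • y) ∂μ) x := by
  refine hasFDerivAt_integral_of_dominated_of_fderiv_le (s := Set.univ) (bound := fun _ => L)
    (F' := fun x y => fderiv ℝ f (x + √τ • y)) Filter.univ_mem ?_ ?_ ?_ ?_ (integrable_const L) ?_
  · have := hf.continuous
    exact Filter.Eventually.of_forall fun x => Continuous.aestronglyMeasurable (by fun_prop)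
  · have := hf.continuous
    exact Continuous.integrable_of_bounded' (by fun_prop) fun y => hf.abs_le_max _
  · have := hf.continuous_fderiv
    exact Continuous.aestronglyMeasurable (by fun_prop)
  · exact Filter.Eventually.of_forall fun y x _ => hf.norm_fderiv_le _
  · refine Filter.Eventually.of_forall fun y x _ => ?_
    have h1 := (hf.differentiable (x + √τ • y)).hasFDerivAt
    exact (hasFDerivAt_comp_add_right (√τ • y)).2 h1

omit [CompleteSpace E] in
-- Averaging over translates preserves all the bounds with the same constants. This is what allows a
-- one-step estimate to be iterated with a constant independent of the number of steps.
lemma gaussHeat (hf : IsSmoothBetween c C L f) (τ : ℝ) :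
    IsSmoothBetween c C L (gaussHeat μ τ f) := by
  have hcont := hf.continuous
  have hcont' := hf.continuous_fderiv
  have hint : ∀ x, Integrable (fun y => f (x + √τ • y)) μ := fun x =>
    Continuous.integrable_of_bounded' (by fun_prop) fun y => hf.abs_le_max _
  have hint' : ∀ x, Integrable (fun y => fderiv ℝ f (x + √τ • y)) μ := fun x =>
    Integrable.of_bound (Continuous.aestronglyMeasurable (by fun_prop)) L
      (Filter.Eventually.of_forall fun y => hf.norm_fderiv_le _)
  refine ⟨fun x => (hf.hasFDerivAt_gaussHeat τ x).differentiableAt, fun x => ?_, fun x => ?_,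
    fun x => ?_, fun x y => ?_⟩
  · have := integral_mono (integrable_const c) (hint x) fun y => hf.ge _
    simpa [_root_.gaussHeat] using this
  · have := integral_mono (hint x) (integrable_const C) fun y => hf.le _
    simpa [_root_.gaussHeat] using this
  · rw [(hf.hasFDerivAt_gaussHeat τ x).fderiv]
    have := norm_integral_le_of_norm_le_const (μ := μ)
      (f := fun y => fderiv ℝ f (x + √τ • y)) (C := L)
      (Filter.Eventually.of_forall fun y => hf.norm_fderiv_le _)
    simpa using this
  · rw [(hf.hasFDerivAt_gaussHeat τ x).fderiv, (hf.hasFDerivAt_gaussHeat τ y).fderiv,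
      ← integral_sub (hint' x) (hint' y)]
    have := norm_integral_le_of_norm_le_const (μ := μ)
      (f := fun z => fderiv ℝ f (x + √τ • z) - fderiv ℝ f (y + √τ • z)) (C := L * ‖x - y‖)
      (Filter.Eventually.of_forall fun z => by
        simpa using hf.norm_fderiv_sub_le (x + √τ • z) (y + √τ • z))
    simpa using this

end IsSmoothBetween

end GaussHeat

/-! ### Correlated Gaussian pairs and one step of the heat flow -/

section CorrPair

variable {E : Type*} [NormedAddCommGroup E] [NormedSpace ℝ E] [MeasurableSpace E] [BorelSpace E]
  [SecondCountableTopology E] {μ : Measure E}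

/-- The law of `(X, ρ X + σ Y)` for independent `X`, `Y` of law `μ`. -/
noncomputable def corrPair (μ : Measure E) (ρ σ : ℝ) : Measure (E × E) :=
  (μ.prod μ).map (fun z : E × E => (z.1, ρ • z.1 + σ • z.2))

lemma map_fst_corrPair [IsProbabilityMeasure μ] (ρ σ : ℝ) :
    (corrPair μ ρ σ).map Prod.fst = μ := by
  rw [corrPair, Measure.map_map (by fun_prop) (by fun_prop)]
  have : Prod.fst ∘ (fun z : E × E => (z.1, ρ • z.1 + σ • z.2)) = Prod.fst := rfl
  rw [this, Measure.map_fst_prod, measure_univ, one_smul]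

instance [IsProbabilityMeasure μ] (ρ σ : ℝ) : IsProbabilityMeasure (corrPair μ ρ σ) :=
  Measure.isProbabilityMeasure_map (by fun_prop)

variable [CompleteSpace E] [IsGaussian μ]

instance (ρ σ : ℝ) : IsGaussian (corrPair μ ρ σ) := by
  have : corrPair μ ρ σ = (μ.prod μ).map ((ContinuousLinearMap.fst ℝ E E).prod
    (ρ • ContinuousLinearMap.fst ℝ E E + σ • ContinuousLinearMap.snd ℝ E E)) := rfl
  rw [this]
  infer_instance

lemma map_snd_corrPair (hμ : ∫ x, x ∂μ = 0) {ρ σ : ℝ} (h : ρ ^ 2 + σ ^ 2 = 1) :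
    (corrPair μ ρ σ).map Prod.snd = μ := by
  rw [corrPair, Measure.map_map (by fun_prop) (by fun_prop)]
  exact IsGaussian.map_smul_add_smul hμ h

lemma integral_id_corrPair (hμ : ∫ x, x ∂μ = 0) {ρ σ : ℝ} (h : ρ ^ 2 + σ ^ 2 = 1) :
    ∫ z, z ∂(corrPair μ ρ σ) = 0 := by
  have hi : Integrable (fun z : E × E => z) (corrPair μ ρ σ) := IsGaussian.integrable_id
  have h1 := integral_map (μ := corrPair μ ρ σ) (φ := Prod.fst) (f := fun x : E => x)
    (by fun_prop) (by fun_prop)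
  have h2 := integral_map (μ := corrPair μ ρ σ) (φ := Prod.snd) (f := fun x : E => x)
    (by fun_prop) (by fun_prop)
  rw [map_fst_corrPair, hμ] at h1
  rw [map_snd_corrPair hμ h, hμ] at h2
  exact Prod.ext ((fst_integral hi).trans h1.symm) ((snd_integral hi).trans h2.symm)

omit [CompleteSpace E] in
lemma integral_fst_corrPair (ρ σ : ℝ) {f : E → ℝ} (hf : Continuous f) :
    ∫ z, f z.1 ∂(corrPair μ ρ σ) = ∫ x, f x ∂μ := by
  conv_rhs => rw [← map_fst_corrPair (μ := μ) ρ σ]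
  rw [integral_map (by fun_prop) hf.aestronglyMeasurable]

lemma integral_snd_corrPair (hμ : ∫ x, x ∂μ = 0) {ρ σ : ℝ} (h : ρ ^ 2 + σ ^ 2 = 1) {f : E → ℝ}
    (hf : Continuous f) : ∫ z, f z.2 ∂(corrPair μ ρ σ) = ∫ x, f x ∂μ := by
  conv_rhs => rw [← map_snd_corrPair hμ h]
  rw [integral_map (by fun_prop) hf.aestronglyMeasurable]

/-- The second coordinate is `ρ X + σ Y` with `Y` independent of `X` and centered, so only the part
`ρ X` correlates with `X`. -/
lemma integral_dual_mul_dual_corrPair (hμ : ∫ x, x ∂μ = 0) (ρ σ : ℝ) (l m : StrongDual ℝ E) :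
    ∫ z, l z.1 * m z.2 ∂(corrPair μ ρ σ) = ρ * ∫ x, l x * m x ∂μ := by
  have hl : MemLp l 2 μ := IsGaussian.memLp_dual μ l 2 (by simp)
  have hm : MemLp m 2 μ := IsGaussian.memLp_dual μ m 2 (by simp)
  have h1 : Integrable (fun z : E × E => l z.1 * m z.1) (μ.prod μ) :=
    (hl.integrable_mul hm).comp_fst μ
  have h2 : Integrable (fun z : E × E => l z.1 * m z.2) (μ.prod μ) :=
    (IsGaussian.integrable_dual μ l).mul_prod (IsGaussian.integrable_dual μ m)
  rw [corrPair, integral_map (by fun_prop) (Continuous.aestronglyMeasurable (by fun_prop))]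
  have e : ∀ z : E × E, l z.1 * m (ρ • z.1 + σ • z.2)
      = ρ * (l z.1 * m z.1) + σ * (l z.1 * m z.2) := by
    intro z; simp; ring
  simp_rw [e]
  rw [integral_add (h1.const_mul ρ) (h2.const_mul σ), integral_const_mul, integral_const_mul,
    integral_fun_fst (fun x => l x * m x), integral_prod_mul (fun x => l x) (fun x => m x),
    IsGaussian.integral_dual m, hμ]
  simp

/-- Gaussian measures have moments of all orders; the sixth controls the remainder of the one-step
expansion. -/
lemma integrable_one_add_norm_pow (ν : Measure (E × E)) [IsGaussian ν] (n : ℕ) :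
    Integrable (fun z : E × E => (1 + ‖z.1‖ + ‖z.2‖) ^ n) ν := by
  have h0 : MemLp (fun z : E × E => z) (n : ENNReal) ν :=
    IsGaussian.memLp_id ν n (ENNReal.natCast_ne_top n)
  have h2 : MemLp (fun z : E × E => 1 + 2 * ‖z‖) (n : ENNReal) ν :=
    (memLp_const (1 : ℝ)).add (h0.norm.const_mul (2 : ℝ))
  refine h2.integrable_norm_pow'.mono (Continuous.aestronglyMeasurable (by fun_prop))
    (Filter.Eventually.of_forall fun z => ?_)
  have h1 := norm_fst_le z
  have h2 := norm_snd_le z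
  have e : ‖1 + 2 * ‖z‖‖ = 1 + 2 * ‖z‖ := Real.norm_of_nonneg (by positivity)
  rw [e, Real.norm_of_nonneg (by positivity), Real.norm_of_nonneg (by positivity)]
  exact pow_le_pow_left₀ (by positivity) (by linarith) n

lemma integrable_norm_sq (μ : Measure E) [IsGaussian μ] : Integrable (fun y : E => ‖y‖ ^ 2) μ :=
  (IsGaussian.memLp_id μ 2 (by simp)).norm.integrable_sq

namespace IsSmoothBetween

variable {c C L : ℝ} {f g : E → ℝ}

/-- Centering removes the linear Taylor term, so the error is of order `τ` instead of `√τ`.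
Increments can thus be measured from the heat average rather than from `f x` at second-order cost.
-/
lemma abs_gaussHeat_sub_le (hf : IsSmoothBetween c C L f) (hμ : ∫ x, x ∂μ = 0) {τ : ℝ}
    (hτ : 0 ≤ τ) (x : E) : |_root_.gaussHeat μ τ f x - f x| ≤ L * τ * ∫ y, ‖y‖ ^ 2 ∂μ := by
  have hcont := hf.continuous
  have hint : Integrable (fun y => f (x + √τ • y)) μ :=
    Continuous.integrable_of_bounded' (by fun_prop) fun y => hf.abs_le_max _
  have hl : Integrable (fun y => fderiv ℝ f x (√τ • y)) μ := by
    simp only [map_smul]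
    exact (IsGaussian.integrable_dual μ (fderiv ℝ f x)).smul (√τ)
  have hz : ∫ y, fderiv ℝ f x (√τ • y) ∂μ = 0 := by
    simp only [map_smul, smul_eq_mul]
    rw [integral_const_mul, IsGaussian.integral_dual, hμ]; simp
  have e : _root_.gaussHeat μ τ f x - f x
      = ∫ y, (f (x + √τ • y) - f x - fderiv ℝ f x (√τ • y)) ∂μ := by
    rw [integral_sub (f := fun y => f (x + √τ • y) - f x) (hint.sub (integrable_const _)) hl, hz,
      integral_sub hint (integrable_const _)]
    simp [_root_.gaussHeat]
  rw [e, ← integral_const_mul, ← Real.norm_eq_abs]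
  refine norm_integral_le_of_norm_le ((integrable_norm_sq μ).const_mul _)
    (Filter.Eventually.of_forall fun y => ?_)
  refine (hf.abs_sub_fderiv_le x _).trans_eq ?_
  rw [norm_smul, mul_pow, Real.norm_eq_abs, sq_abs, Real.sq_sqrt hτ]
  ring

lemma abs_sub_gaussHeat_sub_le (hf : IsSmoothBetween c C L f) (hμ : ∫ x, x ∂μ = 0) {τ : ℝ}
    (hτ : 0 ≤ τ) (x y : E) :
    |f (x + √τ • y) - _root_.gaussHeat μ τ f x - √τ * fderiv ℝ f x y|
      ≤ L * τ * (‖y‖ ^ 2 + ∫ y, ‖y‖ ^ 2 ∂μ) := by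
  have h1 := hf.abs_gaussHeat_sub_le hμ hτ x
  have h2 := hf.abs_sub_fderiv_le x (√τ • y)
  rw [norm_smul, mul_pow, Real.norm_eq_abs, sq_abs, Real.sq_sqrt hτ, map_smul, smul_eq_mul] at h2
  rw [abs_le] at h1 h2 ⊢
  constructor <;> linarith [h1.1, h1.2, h2.1, h2.2]

/-- The normalised increment of `f` is linear up to a quadratic error. -/
lemma normalized_increment (hf : IsSmoothBetween c C L f) (hc : 0 < c) (hμ : ∫ x, x ∂μ = 0)
    {τ : ℝ} (hτ : 0 ≤ τ) (x y : E) {N : ℝ} (hN : 1 + ‖y‖ ≤ N) :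
    f (x + √τ • y) / _root_.gaussHeat μ τ f x - 1 ∈ Set.Icc (-1 + c / C) (C / c) ∧
    |(_root_.gaussHeat μ τ f x)⁻¹ * fderiv ℝ f x y|
      ≤ L * (1 + ∫ y, ‖y‖ ^ 2 ∂μ) / c * N ∧
    |f (x + √τ • y) / _root_.gaussHeat μ τ f x - 1
      - √τ * ((_root_.gaussHeat μ τ f x)⁻¹ * fderiv ℝ f x y)|
      ≤ L * (1 + ∫ y, ‖y‖ ^ 2 ∂μ) / c * √τ ^ 2 * N ^ 2 := by
  have hu := hf.gaussHeat (μ := μ) τ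
  have huc := hu.ge x
  have huC := hu.le x
  have h3 := hf.abs_sub_gaussHeat_sub_le hμ hτ x y
  set u := _root_.gaussHeat μ τ f x
  set M := ∫ y, ‖y‖ ^ 2 ∂μ
  have hM : 0 ≤ M := integral_nonneg fun y => by positivity
  have hu0 : 0 < u := hc.trans_le huc
  have hL := hf.L_nonneg
  have hy := norm_nonneg y
  have hN1 : 1 ≤ N := by linarith
  have hinv : u⁻¹ ≤ c⁻¹ := inv_anti₀ hc huc
  refine ⟨⟨?_, ?_⟩, ?_, ?_⟩
  · have : c / C ≤ f (x + √τ • y) / u :=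
      div_le_div₀ (hc.le.trans (hf.ge _)) (hf.ge _) hu0 huC
    linarith
  · have : f (x + √τ • y) / u ≤ C / c :=
      div_le_div₀ (hu0.le.trans huC) (hf.le _) hc huc
    linarith
  · rw [abs_mul, abs_of_pos (inv_pos.2 hu0)]
    calc u⁻¹ * |fderiv ℝ f x y| ≤ c⁻¹ * (L * ‖y‖) := by
          gcongr
          exact (fderiv ℝ f x).le_of_opNorm_le (hf.norm_fderiv_le x) y
      _ ≤ c⁻¹ * (L * (1 + M) * N) := by
          gcongr
          · nlinarith
          · linarith
      _ = _ := by ring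
  · have e : f (x + √τ • y) / u - 1 - √τ * (u⁻¹ * fderiv ℝ f x y)
        = u⁻¹ * (f (x + √τ • y) - u - √τ * fderiv ℝ f x y) := by
      field_simp
    rw [e, abs_mul, abs_of_pos (inv_pos.2 hu0), Real.sq_sqrt hτ]
    calc u⁻¹ * |f (x + √τ • y) - u - √τ * fderiv ℝ f x y|
        ≤ c⁻¹ * (L * τ * (‖y‖ ^ 2 + M)) := by gcongr
      _ ≤ c⁻¹ * (L * τ * ((1 + M) * N ^ 2)) := by
          gcongr
          have h1 : ‖y‖ ^ 2 ≤ N ^ 2 := by gcongr; linarith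
          have h2 : 1 ≤ N ^ 2 := one_le_pow₀ hN1
          nlinarith
      _ = _ := by ring

end IsSmoothBetween

/-- One small time step of the heat flow decreases `f ^ α g ^ β` up to an error `O(τ ^ (3/2))`. -/
lemma exists_gaussHeat_corrPair_le (hμ : ∫ x, x ∂μ = 0) {ρ σ α β c C L : ℝ}
    (h : ρ ^ 2 + σ ^ 2 = 1) (hα : α ∈ Set.Ioo (0 : ℝ) 1) (hβ : β ∈ Set.Ioo (0 : ℝ) 1)
    (hρ : ρ ^ 2 * (α * β) ≤ (1 - α) * (1 - β)) (hc : 0 < c) (hcC : c ≤ C) (hL : 0 ≤ L) :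
    ∃ K, 0 ≤ K ∧ ∀ f g : E → ℝ, IsSmoothBetween c C L f → IsSmoothBetween c C L g →
      ∀ τ ∈ Set.Icc (0 : ℝ) 1, ∀ z : E × E,
        gaussHeat (corrPair μ ρ σ) τ (fun w : E × E => f w.1 ^ α * g w.2 ^ β) z
          ≤ gaussHeat μ τ f z.1 ^ α * gaussHeat μ τ g z.2 ^ β + K * √τ ^ 3 := by
  set M := ∫ y, ‖y‖ ^ 2 ∂μ with hM
  have hM0 : 0 ≤ M := integral_nonneg fun y => by positivity
  have hC : 0 < C := hc.trans_le hcC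
  -- The parameters are exactly the bounds supplied by `normalized_increment`: the interval `[-1 +
  -- c/C, C/c]` and the constant `L (1 + M) / c`.
  obtain ⟨K, hK, H⟩ := exists_one_add_rpow_mul_le_of_approx α β (c / C) (C / c)
    (L * (1 + M) / c) hα hβ (by positivity) (by rw [div_le_one hC]; exact hcC) (by positivity)
    (by positivity)
  set ν := corrPair μ ρ σ with hν
  set M6 := ∫ z : E × E, (1 + ‖z.1‖ + ‖z.2‖) ^ 6 ∂ν with hM6
  have hM60 : 0 ≤ M6 := integral_nonneg fun y => by positivity
  refine ⟨C ^ α * C ^ β * (K * M6), by positivity, fun f g hf hg τ hτ z => ?_⟩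
  obtain ⟨x, y⟩ := z
  have hcf := hf.continuous
  have hcg := hg.continuous
  have hu := hf.gaussHeat (μ := μ) τ
  have hv := hg.gaussHeat (μ := μ) τ
  have huc := hu.ge x
  have huC := hu.le x
  have hvc := hv.ge y
  have hvC := hv.le y
  have hfn := fun w {N} => hf.normalized_increment (N := N) hc hμ hτ.1 x w
  have hgn := fun w {N} => hg.normalized_increment (N := N) hc hμ hτ.1 y w
  have hua : ∫ w, f (x + √τ • w) ∂μ = gaussHeat μ τ f x := rfl
  have hva : ∫ w, g (y + √τ • w) ∂μ = gaussHeat μ τ g y := rfl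
  simp only
  set u := gaussHeat μ τ f x
  set v := gaussHeat μ τ g y
  have hu0 : 0 < u := hc.trans_le huc
  have hv0 : 0 < v := hc.trans_le hvc
  set l : StrongDual ℝ E := u⁻¹ • fderiv ℝ f x with hl
  set m : StrongDual ℝ E := v⁻¹ • fderiv ℝ g y with hm
  set a : E → ℝ := fun w => f (x + √τ • w) / u - 1 with ha
  set b : E → ℝ := fun w => g (y + √τ • w) / v - 1 with hb
  have hac : Continuous a := by simp only [ha]; fun_prop
  have hbc : Continuous b := by simp only [hb]; fun_prop
  have hfi : Integrable (fun w => f (x + √τ • w)) μ :=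
    Continuous.integrable_of_bounded' (by fun_prop) fun w => hf.abs_le_max _
  have hgi : Integrable (fun w => g (y + √τ • w)) μ :=
    Continuous.integrable_of_bounded' (by fun_prop) fun w => hg.abs_le_max _
  -- Normalising by `u = P_τ f (x)` instead of `f x` makes the first-order term vanish exactly.
  have ha0 : ∫ w, a w ∂μ = 0 := by
    rw [integral_sub (hfi.div_const u) (integrable_const _), integral_div, hua, div_self hu0.ne']
    simp
  have hb0 : ∫ w, b w ∂μ = 0 := by
    rw [integral_sub (hgi.div_const v) (integrable_const _), integral_div, hva, div_self hv0.ne']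
    simp
  have hbound : ∀ w ∈ Set.Icc (-1 + c / C) (C / c), |w| ≤ max 1 (C / c) := by
    intro w hw
    have : 0 < c / C := by positivity
    rw [abs_le]
    constructor
    · linarith [hw.1, le_max_left 1 (C / c)]
    · exact hw.2.trans (le_max_right _ _)
  have hai : Integrable (fun w : E × E => a w.1) ν :=
    Continuous.integrable_of_bounded' (by fun_prop) fun w => hbound _ (hfn w.1 le_rfl).1
  have hbi : Integrable (fun w : E × E => b w.2) ν :=
    Continuous.integrable_of_bounded' (by fun_prop) fun w => hbound _ (hgn w.2 le_rfl).1
  have hlν : MemLp (fun w : E × E => l w.1) 2 ν :=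
    IsGaussian.memLp_dual ν (l ∘L ContinuousLinearMap.fst ℝ E E) 2 (by simp)
  have hmν : MemLp (fun w : E × E => m w.2) 2 ν :=
    IsGaussian.memLp_dual ν (m ∘L ContinuousLinearMap.snd ℝ E E) 2 (by simp)
  have hlμ : MemLp l 2 μ := IsGaussian.memLp_dual μ l 2 (by simp)
  have hmμ : MemLp m 2 μ := IsGaussian.memLp_dual μ m 2 (by simp)
  have hlm : Integrable (fun w : E × E => α * β * (l w.1 * m w.2)) ν :=
    (hlν.integrable_mul hmν).const_mul _
  have hll : Integrable (fun w : E × E => α * (1 - α) / 2 * l w.1 ^ 2) ν :=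
    hlν.integrable_sq.const_mul _
  have hmm : Integrable (fun w : E × E => β * (1 - β) / 2 * m w.2 ^ 2) ν :=
    hmν.integrable_sq.const_mul _
  -- Both marginals are `μ` and the cross moment gains the factor `ρ`, so the expectation under `ν`
  -- equals an integral over `μ` whose integrand is pointwise nonpositive.
  have hquad : ∫ w : E × E, (α * β * (l w.1 * m w.2) - α * (1 - α) / 2 * l w.1 ^ 2
      - β * (1 - β) / 2 * m w.2 ^ 2) ∂ν ≤ 0 := by
    have e : ∫ w : E × E, (α * β * (l w.1 * m w.2) - α * (1 - α) / 2 * l w.1 ^ 2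
      - β * (1 - β) / 2 * m w.2 ^ 2) ∂ν = ∫ w, (α * β * (ρ * (l w * m w))
        - α * (1 - α) / 2 * l w ^ 2 - β * (1 - β) / 2 * m w ^ 2) ∂μ := by
      rw [integral_sub (f := fun w : E × E => α * β * (l w.1 * m w.2)
          - α * (1 - α) / 2 * l w.1 ^ 2) (hlm.sub hll) hmm, integral_sub hlm hll, integral_const_mul,
        integral_dual_mul_dual_corrPair hμ,
        integral_fst_corrPair ρ σ (f := fun w => α * (1 - α) / 2 * l w ^ 2) (by fun_prop),
        integral_snd_corrPair hμ h (f := fun w => β * (1 - β) / 2 * m w ^ 2) (by fun_prop)]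
      have i1 : Integrable (fun w => α * β * (ρ * (l w * m w))) μ :=
        ((hlμ.integrable_mul hmμ).const_mul ρ).const_mul _
      have i2 : Integrable (fun w => α * (1 - α) / 2 * l w ^ 2) μ := hlμ.integrable_sq.const_mul _
      have i3 : Integrable (fun w => β * (1 - β) / 2 * m w ^ 2) μ := hmμ.integrable_sq.const_mul _
      rw [integral_sub (f := fun w => α * β * (ρ * (l w * m w)) - α * (1 - α) / 2 * l w ^ 2)
        (i1.sub i2) i3, integral_sub i1 i2, integral_const_mul (α * β), integral_const_mul ρ]
    rw [e]
    exact integral_nonpos fun w => correlated_quadratic_nonpos hα hβ hρ _ _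
  have hpt : ∀ w : E × E, f (x + √τ • w.1) ^ α * g (y + √τ • w.2) ^ β
      ≤ u ^ α * v ^ β * (1 + α * a w.1 + β * b w.2
        + √τ ^ 2 * (α * β * (l w.1 * m w.2) - α * (1 - α) / 2 * l w.1 ^ 2
          - β * (1 - β) / 2 * m w.2 ^ 2)
        + K * √τ ^ 3 * (1 + ‖w.1‖ + ‖w.2‖) ^ 6) := by
    intro w
    have n1 := norm_nonneg w.1
    have n2 := norm_nonneg w.2
    obtain ⟨a1, a2, a3⟩ := hfn w.1 (N := 1 + ‖w.1‖ + ‖w.2‖) (by linarith)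
    obtain ⟨b1, b2, b3⟩ := hgn w.2 (N := 1 + ‖w.1‖ + ‖w.2‖) (by linarith)
    have := H _ a1 _ b1 √τ ⟨Real.sqrt_nonneg _, Real.sqrt_le_one.2 hτ.2⟩ (l w.1) (m w.2) _
      (by linarith) a2 b2 a3 b3
    have ef : f (x + √τ • w.1) ^ α = u ^ α * (1 + a w.1) ^ α := by
      have h1 : 0 ≤ 1 + a w.1 := by
        simp only [ha, add_sub_cancel]; exact div_nonneg (hc.le.trans (hf.ge _)) hu0.le
      rw [← Real.mul_rpow hu0.le h1]
      simp only [ha, add_sub_cancel]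
      rw [mul_div_cancel₀ _ hu0.ne']
    have eg : g (y + √τ • w.2) ^ β = v ^ β * (1 + b w.2) ^ β := by
      have h1 : 0 ≤ 1 + b w.2 := by
        simp only [hb, add_sub_cancel]; exact div_nonneg (hc.le.trans (hg.ge _)) hv0.le
      rw [← Real.mul_rpow hv0.le h1]
      simp only [hb, add_sub_cancel]
      rw [mul_div_cancel₀ _ hv0.ne']
    rw [ef, eg, mul_mul_mul_comm]
    gcongr
  have hN6 : Integrable (fun w : E × E => K * √τ ^ 3 * (1 + ‖w.1‖ + ‖w.2‖) ^ 6) ν :=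
    (integrable_one_add_norm_pow ν 6).const_mul _
  have hq : Integrable (fun w : E × E => √τ ^ 2 * (α * β * (l w.1 * m w.2)
      - α * (1 - α) / 2 * l w.1 ^ 2 - β * (1 - β) / 2 * m w.2 ^ 2)) ν :=
    ((hlm.sub hll).sub hmm).const_mul (√τ ^ 2)
  have i1 : Integrable (fun w : E × E => 1 + α * a w.1) ν :=
    (integrable_const (μ := ν) (1 : ℝ)).add (hai.const_mul α)
  have i2 : Integrable (fun w : E × E => 1 + α * a w.1 + β * b w.2) ν := i1.add (hbi.const_mul β)
  have i3 : Integrable (fun w : E × E => 1 + α * a w.1 + β * b w.2 + √τ ^ 2 *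
      (α * β * (l w.1 * m w.2) - α * (1 - α) / 2 * l w.1 ^ 2 - β * (1 - β) / 2 * m w.2 ^ 2)) ν :=
    i2.add hq
  have i4 := i3.add hN6
  have hα0 := hα.1
  have hβ0 := hβ.1
  calc gaussHeat ν τ (fun w : E × E => f w.1 ^ α * g w.2 ^ β) (x, y)
      = ∫ w : E × E, f (x + √τ • w.1) ^ α * g (y + √τ • w.2) ^ β ∂ν := rfl
    _ ≤ ∫ w : E × E, u ^ α * v ^ β * (1 + α * a w.1 + β * b w.2
        + √τ ^ 2 * (α * β * (l w.1 * m w.2) - α * (1 - α) / 2 * l w.1 ^ 2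
          - β * (1 - β) / 2 * m w.2 ^ 2)
        + K * √τ ^ 3 * (1 + ‖w.1‖ + ‖w.2‖) ^ 6) ∂ν := by
        refine integral_mono_of_nonneg (Filter.Eventually.of_forall fun w => ?_) (i4.const_mul _)
          (Filter.Eventually.of_forall hpt)
        exact mul_nonneg (Real.rpow_nonneg (hc.le.trans (hf.ge _)) _)
          (Real.rpow_nonneg (hc.le.trans (hg.ge _)) _)
    _ = u ^ α * v ^ β * (1 + √τ ^ 2 * ∫ w : E × E, (α * β * (l w.1 * m w.2)
          - α * (1 - α) / 2 * l w.1 ^ 2 - β * (1 - β) / 2 * m w.2 ^ 2) ∂ν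
          + K * √τ ^ 3 * M6) := by
        rw [integral_const_mul]
        congr 1
        rw [integral_add i3 hN6, integral_add i2 hq, integral_add i1 (hbi.const_mul β),
          integral_add (integrable_const _) (hai.const_mul α), integral_const_mul,
          integral_const_mul, integral_const_mul, integral_const_mul,
          integral_fst_corrPair ρ σ hac, integral_snd_corrPair hμ h hbc, ha0, hb0, ← hM6]
        simp
    _ ≤ u ^ α * v ^ β * (1 + 0 + K * √τ ^ 3 * M6) := by
        gcongr
        exact mul_nonpos_of_nonneg_of_nonpos (by positivity) hquad
    _ = u ^ α * v ^ β + u ^ α * v ^ β * (K * √τ ^ 3 * M6) := by ring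
    _ ≤ u ^ α * v ^ β + C ^ α * C ^ β * (K * √τ ^ 3 * M6) := by gcongr
    _ = _ := by ring

end CorrPair

/-! ### The two-function inequality: iteration and approximation -/

section TwoFunction

variable {E : Type*} [NormedAddCommGroup E] [NormedSpace ℝ E] [MeasurableSpace E] [BorelSpace E]
  [SecondCountableTopology E] {μ : Measure E}

omit [MeasurableSpace E] [BorelSpace E] [SecondCountableTopology E] in
lemma IsSmoothBetween.mono {c c' C C' L L' : ℝ} {f : E → ℝ} (hf : IsSmoothBetween c C L f)
    (hc : c' ≤ c) (hC : C ≤ C') (hL : L ≤ L') : IsSmoothBetween c' C' L' f :=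
  ⟨hf.differentiable, fun x => hc.trans (hf.ge x), fun x => (hf.le x).trans hC,
    fun x => (hf.norm_fderiv_le x).trans hL,
    fun x y => (hf.norm_fderiv_sub_le x y).trans (by gcongr)⟩

/-- Each step is averaged against a probability measure, so the errors `K` simply add up; the
induction hypothesis is applied to `P_τ f` and `P_τ g`, which lie in the same class as `f` and `g`.
-/
lemma gaussHeat_corrPair_iterate_le [CompleteSpace E] [IsGaussian μ]
    (hμ : ∫ x, x ∂μ = 0) {ρ σ α β c C L K : ℝ}
    (h : ρ ^ 2 + σ ^ 2 = 1) (hα : 0 < α) (hβ : 0 < β) (hc : 0 < c) {τ : ℝ} (hτ : 0 ≤ τ)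
    (hK : ∀ f g : E → ℝ, IsSmoothBetween c C L f → IsSmoothBetween c C L g → ∀ z : E × E,
      gaussHeat (corrPair μ ρ σ) τ (fun w : E × E => f w.1 ^ α * g w.2 ^ β) z
        ≤ gaussHeat μ τ f z.1 ^ α * gaussHeat μ τ g z.2 ^ β + K) (n : ℕ) :
    ∀ f g : E → ℝ, IsSmoothBetween c C L f → IsSmoothBetween c C L g → ∀ z : E × E,
      gaussHeat (corrPair μ ρ σ) (n * τ) (fun w : E × E => f w.1 ^ α * g w.2 ^ β) z
        ≤ gaussHeat μ (n * τ) f z.1 ^ α * gaussHeat μ (n * τ) g z.2 ^ β + n * K := by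
  set ν := corrPair μ ρ σ with hν
  have hνc : ∫ z, z ∂ν = 0 := integral_id_corrPair hμ h
  have hcont : ∀ f g : E → ℝ, IsSmoothBetween c C L f → IsSmoothBetween c C L g →
      Continuous (fun w : E × E => f w.1 ^ α * g w.2 ^ β) := fun f g hf hg =>
    ((hf.continuous.comp continuous_fst).rpow_const fun _ => Or.inr hα.le).mul
      ((hg.continuous.comp continuous_snd).rpow_const fun _ => Or.inr hβ.le)
  have hbd : ∀ f g : E → ℝ, IsSmoothBetween c C L f → IsSmoothBetween c C L g →
      ∀ w : E × E, |f w.1 ^ α * g w.2 ^ β| ≤ C ^ α * C ^ β := by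
    intro f g hf hg w
    have h1 := hc.le.trans (hf.ge w.1)
    have h2 := hc.le.trans (hg.ge w.2)
    have h3 := h1.trans (hf.le w.1)
    rw [abs_of_nonneg (by positivity)]
    gcongr
    · exact hf.le _
    · exact hg.le _
  induction n with
  | zero => intro f g _ _ z; simp
  | succ n ih =>
    intro f g hf hg z
    have hn : 0 ≤ n * τ := by positivity
    have e : ((n + 1 : ℕ) : ℝ) * τ = n * τ + τ := by push_cast; ring
    have hf' := hf.gaussHeat (μ := μ) τ
    have hg' := hg.gaussHeat (μ := μ) τ
    rw [e, ← gaussHeat_gaussHeat hνc (hcont f g hf hg) (hbd f g hf hg) hn hτ,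
      ← gaussHeat_gaussHeat hμ hf.continuous hf.abs_le_max hn hτ,
      ← gaussHeat_gaussHeat hμ hg.continuous hg.abs_le_max hn hτ]
    have hc1 := hcont _ _ hf' hg'
    have hc2 := continuous_gaussHeat (μ := ν) (hcont f g hf hg) (hbd f g hf hg) τ
    have hi : Integrable (fun w : E × E => gaussHeat μ τ f (z + √(n * τ) • w).1 ^ α
        * gaussHeat μ τ g (z + √(n * τ) • w).2 ^ β) ν := by
      refine Continuous.integrable_of_bounded' ?_ fun w => hbd _ _ hf' hg' (z + √(n * τ) • w)
      exact hc1.comp (by fun_prop : Continuous fun w : E × E => z + √(n * τ) • w)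
    calc gaussHeat ν (n * τ) (gaussHeat ν τ fun w : E × E => f w.1 ^ α * g w.2 ^ β) z
        ≤ ∫ w : E × E, (gaussHeat μ τ f (z + √(n * τ) • w).1 ^ α
          * gaussHeat μ τ g (z + √(n * τ) • w).2 ^ β + K) ∂ν := by
          refine integral_mono (Continuous.integrable_of_bounded' ?_ fun w =>
            abs_gaussHeat_le (hbd f g hf hg) τ _) (hi.add (integrable_const _))
            fun w => hK f g hf hg _
          exact hc2.comp (by fun_prop : Continuous fun w : E × E => z + √(n * τ) • w)
      _ = gaussHeat ν (n * τ) (fun w : E × E => gaussHeat μ τ f w.1 ^ α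
          * gaussHeat μ τ g w.2 ^ β) z + K := by
          rw [integral_add hi (integrable_const _)]
          simp [gaussHeat]
      _ ≤ _ := by
          have := ih _ _ hf' hg' z
          push_cast
          linarith

lemma IsSmoothBetween.integral_rpow_mul_rpow_corrPair_le [CompleteSpace E] [IsGaussian μ]
    (hμ : ∫ x, x ∂μ = 0) {ρ σ α β c C L : ℝ}
    (h : ρ ^ 2 + σ ^ 2 = 1) (hα : α ∈ Set.Ioo (0 : ℝ) 1) (hβ : β ∈ Set.Ioo (0 : ℝ) 1)
    (hρ : ρ ^ 2 * (α * β) ≤ (1 - α) * (1 - β)) (hc : 0 < c) {f g : E → ℝ}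
    (hf : IsSmoothBetween c C L f) (hg : IsSmoothBetween c C L g) :
    ∫ z, f z.1 ^ α * g z.2 ^ β ∂(corrPair μ ρ σ) ≤ (∫ x, f x ∂μ) ^ α * (∫ x, g x ∂μ) ^ β := by
  obtain ⟨K, hK, H⟩ := exists_gaussHeat_corrPair_le hμ h hα hβ hρ hc
    ((hf.ge 0).trans (hf.le 0)) hf.L_nonneg
  have key : ∀ n : ℕ, ∫ z, f z.1 ^ α * g z.2 ^ β ∂(corrPair μ ρ σ)
      ≤ (∫ x, f x ∂μ) ^ α * (∫ x, g x ∂μ) ^ β + K * √(1 / ((n : ℝ) + 1)) := by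
    intro n
    have hn : (0 : ℝ) < n + 1 := by positivity
    have hτ : (1 / ((n : ℝ) + 1)) ∈ Set.Icc (0 : ℝ) 1 :=
      ⟨by positivity, by rw [div_le_one hn]; linarith [Nat.cast_nonneg (α := ℝ) n]⟩
    -- With `n + 1` steps of size `1 / (n + 1)` the total time is `1`, and the heat average at the
    -- origin at time `1` is the plain integral.
    have := gaussHeat_corrPair_iterate_le hμ h hα.1 hβ.1 hc hτ.1
      (fun f g hf hg z => H f g hf hg _ hτ z) (n + 1) f g hf hg 0
    have e : ((n + 1 : ℕ) : ℝ) * (1 / ((n : ℝ) + 1)) = 1 := by push_cast; field_simp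
    rw [e] at this
    -- The accumulated error is the number of steps `1/τ` times `K τ^(3/2)`.
    have e2 : ((n + 1 : ℕ) : ℝ) * (K * √(1 / ((n : ℝ) + 1)) ^ 3) = K * √(1 / ((n : ℝ) + 1)) := by
      rw [pow_succ, Real.sq_sqrt hτ.1]; push_cast; field_simp
    rw [e2] at this
    simpa [_root_.gaussHeat] using this
  refine ge_of_tendsto' (x := Filter.atTop) ?_ key
  have h1 : Filter.Tendsto (fun n : ℕ => √(1 / ((n : ℝ) + 1))) Filter.atTop (nhds 0) := by
    simpa using (tendsto_one_div_add_atTop_nhds_zero_nat (𝕜 := ℝ)).sqrt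
  simpa using (h1.const_mul K).const_add ((∫ x, f x ∂μ) ^ α * (∫ x, g x ∂μ) ^ β)

lemma integral_rpow_mul_rpow_le_of_tendsto {X : Type*} [TopologicalSpace X] [MeasurableSpace X]
    [BorelSpace X] [SecondCountableTopology X] {μ : Measure X} [IsFiniteMeasure μ]
    {ν : Measure (X × X)} [IsFiniteMeasure ν] {α β C : ℝ} (hα : 0 ≤ α) (hβ : 0 ≤ β)
    {f g : X → ℝ} {F G : ℕ → X → ℝ} (hF : ∀ n, Continuous (F n)) (hG : ∀ n, Continuous (G n))
    (hFC : ∀ n x, F n x ∈ Set.Icc 0 C) (hGC : ∀ n x, G n x ∈ Set.Icc 0 C)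
    (hFf : ∀ x, Filter.Tendsto (fun n => F n x) Filter.atTop (nhds (f x)))
    (hGg : ∀ x, Filter.Tendsto (fun n => G n x) Filter.atTop (nhds (g x)))
    (H : ∀ n, ∫ z, F n z.1 ^ α * G n z.2 ^ β ∂ν ≤ (∫ x, F n x ∂μ) ^ α * (∫ x, G n x ∂μ) ^ β) :
    ∫ z, f z.1 ^ α * g z.2 ^ β ∂ν ≤ (∫ x, f x ∂μ) ^ α * (∫ x, g x ∂μ) ^ β := by
  have hlim : ∀ {F : ℕ → X → ℝ} {f : X → ℝ}, (∀ n, Continuous (F n)) →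
      (∀ n x, F n x ∈ Set.Icc 0 C) →
      (∀ x, Filter.Tendsto (fun n => F n x) Filter.atTop (nhds (f x))) →
      Filter.Tendsto (fun n => ∫ x, F n x ∂μ) Filter.atTop (nhds (∫ x, f x ∂μ)) := by
    intro F f hF hFC hFf
    refine tendsto_integral_of_dominated_convergence (fun _ => C)
      (fun n => (hF n).aestronglyMeasurable) (integrable_const _) (fun n => ?_)
      (Filter.Eventually.of_forall hFf)
    exact Filter.Eventually.of_forall fun x => by
      rw [Real.norm_of_nonneg (hFC n x).1]; exact (hFC n x).2
  have hl : Filter.Tendsto (fun n => ∫ z, F n z.1 ^ α * G n z.2 ^ β ∂ν) Filter.atTop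
      (nhds (∫ z, f z.1 ^ α * g z.2 ^ β ∂ν)) := by
    refine tendsto_integral_of_dominated_convergence (fun _ => C ^ α * C ^ β)
      (fun n => Continuous.aestronglyMeasurable ?_) (integrable_const _) (fun n => ?_)
      (Filter.Eventually.of_forall fun z => ?_)
    · exact (((hF n).comp continuous_fst).rpow_const fun _ => Or.inr hα).mul
        (((hG n).comp continuous_snd).rpow_const fun _ => Or.inr hβ)
    · refine Filter.Eventually.of_forall fun z => ?_
      obtain ⟨h1, h2⟩ := hFC n z.1
      obtain ⟨h3, h4⟩ := hGC n z.2
      rw [Real.norm_of_nonneg (by positivity)]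
      have := h1.trans h2
      gcongr
    · exact ((hFf z.1).rpow_const (Or.inr hα)).mul ((hGg z.2).rpow_const (Or.inr hβ))
  exact le_of_tendsto_of_tendsto' hl
    (((hlim hF hFC hFf).rpow_const (Or.inr hα)).mul ((hlim hG hGC hGg).rpow_const (Or.inr hβ))) H

omit [MeasurableSpace E] [BorelSpace E] [SecondCountableTopology E] in
lemma ContDiff.exists_isSmoothBetween [FiniteDimensional ℝ E] {g : E → ℝ} (hg : ContDiff ℝ 2 g)
    (hgc : HasCompactSupport g) {c C : ℝ} (hc : ∀ x, c ≤ g x) (hC : ∀ x, g x ≤ C) :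
    ∃ L, IsSmoothBetween c C L g := by
  have h1 : ContDiff ℝ 1 (fderiv ℝ g) := hg.fderiv_right (by norm_num)
  obtain ⟨L₁, hL₁⟩ := (hgc.fderiv ℝ).exists_bound_of_continuous h1.continuous
  obtain ⟨L₂, hL₂⟩ := ContDiff.lipschitzWith_of_hasCompactSupport (𝕂 := ℝ) (hgc.fderiv ℝ) h1
    (by norm_num)
  refine ⟨max L₁ L₂, hg.differentiable (by norm_num), hc, hC,
    fun x => (hL₁ x).trans (le_max_left _ _), fun x y => ?_⟩
  refine (hL₂.norm_sub_le x y).trans ?_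
  gcongr
  exact le_max_right _ _

omit [MeasurableSpace E] [BorelSpace E] [SecondCountableTopology E] in
lemma IsSmoothBetween.add_const {c C L : ℝ} {f : E → ℝ} (hf : IsSmoothBetween c C L f) (a : ℝ) :
    IsSmoothBetween (c + a) (C + a) L (fun x => f x + a) := by
  refine ⟨hf.differentiable.add_const a, fun x => by linarith [hf.ge x],
    fun x => by linarith [hf.le x], ?_, ?_⟩
  · simpa using hf.norm_fderiv_le
  · simpa using hf.norm_fderiv_sub_le

omit [MeasurableSpace E] [BorelSpace E] [SecondCountableTopology E] in
-- Multiply `f` by a cutoff equal to one on the ball of radius `R`, then mollify within `ε`. The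
-- result lies in `[-ε, C + ε]`, and adding `2 ε` makes it strictly positive.
lemma exists_isSmoothBetween_dist_le [FiniteDimensional ℝ E] {f : E → ℝ} (hf : Continuous f)
    {C : ℝ} (hfC : ∀ x, f x ∈ Set.Icc 0 C) {R ε : ℝ} (hε : 0 < ε) :
    ∃ g : E → ℝ, ∃ L, IsSmoothBetween ε (C + 3 * ε) L g ∧
      ∀ x, ‖x‖ ≤ R → |g x - f x| ≤ 3 * ε := by
  set χ : E → ℝ := fun x => max 0 (min 1 (R + 1 - ‖x‖)) with hχ
  have hχc : Continuous χ := by simp only [hχ]; fun_prop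
  have hχ0 : ∀ x, 0 ≤ χ x := fun x => le_max_left _ _
  have hχ1 : ∀ x, χ x ≤ 1 := fun x => max_le zero_le_one (min_le_left _ _)
  have hχs : HasCompactSupport χ := by
    refine HasCompactSupport.of_support_subset_isCompact (isCompact_closedBall (0 : E) (R + 1))
      fun x hx => ?_
    by_contra hx'
    rw [mem_closedBall_zero_iff, not_le] at hx'
    exact hx (max_eq_left ((min_le_right _ _).trans (by linarith)))
  have hχR : ∀ x, ‖x‖ ≤ R → χ x = 1 := fun x hx => by
    simp only [hχ]; rw [min_eq_left (by linarith), max_eq_right zero_le_one]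
  have hu : UniformContinuous (χ * f) :=
    (hχs.mul_right (f' := f)).uniformContinuous_of_continuous (hχc.mul hf)
  obtain ⟨δ, hδ, hδu⟩ := Metric.uniformContinuous_iff.1 hu ε hε
  obtain ⟨g, hg, hgd⟩ := (hχc.mul hf).exists_contDiff_dist_le_of_forall_mem_ball_dist_le hδ
  have hgε : ∀ x, |g x - χ x * f x| ≤ ε := fun x => hgd x ε fun y hy => (hδu hy).le
  have hgs : HasCompactSupport g := by
    refine HasCompactSupport.of_support_subset_isCompact
      (hχs.isCompact.cthickening (r := δ)) fun x hx => ?_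
    by_contra hx'
    -- Where the cutoff vanishes on a whole `δ`-ball the approximation property holds with error
    -- zero, so the mollified function vanishes too.
    have hz : ∀ y ∈ Metric.ball x δ, χ y = 0 := fun y hy => by
      by_contra hy'
      exact hx' (Metric.mem_cthickening_of_dist_le x y δ _ (subset_tsupport χ hy')
        (Metric.mem_ball'.1 hy).le)
    have := hgd x 0 fun y hy => by simp [hz y hy, hz x (Metric.mem_ball_self hδ)]
    exact hx (by simpa [hz x (Metric.mem_ball_self hδ)] using this)
  have hb : ∀ x, χ x * f x ∈ Set.Icc 0 C := fun x => by
    obtain ⟨h1, h2⟩ := hfC x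
    exact ⟨mul_nonneg (hχ0 x) h1, (mul_le_of_le_one_left h1 (hχ1 x)).trans h2⟩
  obtain ⟨L, hL⟩ := (show ContDiff ℝ 2 g from mod_cast contDiff_infty.1 hg 2).exists_isSmoothBetween hgs
    (c := -ε) (C := C + ε)
    (fun x => by linarith [(hb x).1, (abs_le.1 (hgε x)).1])
    (fun x => by linarith [(hb x).2, (abs_le.1 (hgε x)).2])
  refine ⟨_, L, (hL.add_const (2 * ε)).mono (by linarith) (by linarith) le_rfl, fun x hx => ?_⟩
  have := abs_le.1 (hgε x)
  rw [hχR x hx, one_mul] at this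
  exact abs_le.2 ⟨by linarith, by linarith⟩

/-- Gaussian two-function hypercontractivity for bounded continuous functions in finite dimension. -/
lemma integral_rpow_mul_rpow_corrPair_le [FiniteDimensional ℝ E] [IsGaussian μ]
    (hμ : ∫ x, x ∂μ = 0) {ρ σ α β C : ℝ}
    (h : ρ ^ 2 + σ ^ 2 = 1) (hα : α ∈ Set.Ioo (0 : ℝ) 1) (hβ : β ∈ Set.Ioo (0 : ℝ) 1)
    (hρ : ρ ^ 2 * (α * β) ≤ (1 - α) * (1 - β)) {f g : E → ℝ}
    (hf : Continuous f) (hg : Continuous g) (hfC : ∀ x, f x ∈ Set.Icc 0 C)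
    (hgC : ∀ x, g x ∈ Set.Icc 0 C) :
    ∫ z, f z.1 ^ α * g z.2 ^ β ∂(corrPair μ ρ σ) ≤ (∫ x, f x ∂μ) ^ α * (∫ x, g x ∂μ) ^ β := by
  have : CompleteSpace E := FiniteDimensional.complete ℝ E
  have hε : ∀ n : ℕ, 0 < 1 / ((n : ℝ) + 1) := fun n => by positivity
  choose F LF hF hFd using fun n : ℕ => exists_isSmoothBetween_dist_le hf hfC (R := n) (hε n)
  choose G LG hG hGd using fun n : ℕ => exists_isSmoothBetween_dist_le hg hgC (R := n) (hε n)
  have hlim : ∀ {f : E → ℝ} {F : ℕ → E → ℝ},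
      (∀ (n : ℕ) x, ‖x‖ ≤ n → |F n x - f x| ≤ 3 * (1 / ((n : ℝ) + 1))) →
      ∀ x, Filter.Tendsto (fun n => F n x) Filter.atTop (nhds (f x)) := by
    intro f F hd x
    rw [tendsto_iff_norm_sub_tendsto_zero]
    refine squeeze_zero' (Filter.Eventually.of_forall fun n => norm_nonneg _)
      (g := fun n : ℕ => 3 * (1 / ((n : ℝ) + 1))) ?_ ?_
    · obtain ⟨N, hN⟩ := exists_nat_ge ‖x‖
      filter_upwards [Filter.eventually_ge_atTop N] with n hn
      exact hd n x (hN.trans (by exact_mod_cast hn))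
    · simpa using (tendsto_one_div_add_atTop_nhds_zero_nat (𝕜 := ℝ)).const_mul 3
  have hle : ∀ n : ℕ, 1 / ((n : ℝ) + 1) ≤ 1 := fun n => by
    rw [div_le_one (by positivity)]; linarith [Nat.cast_nonneg (α := ℝ) n]
  refine integral_rpow_mul_rpow_le_of_tendsto (C := C + 3) hα.1.le hβ.1.le
    (fun n => (hF n).continuous) (fun n => (hG n).continuous)
    (fun n x => ⟨(hε n).le.trans ((hF n).ge x), ((hF n).le x).trans (by linarith [hle n])⟩)
    (fun n x => ⟨(hε n).le.trans ((hG n).ge x), ((hG n).le x).trans (by linarith [hle n])⟩)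
    (hlim hFd) (hlim hGd) fun n => ?_
  exact IsSmoothBetween.integral_rpow_mul_rpow_corrPair_le hμ h hα hβ hρ (hε n)
    ((hF n).mono le_rfl le_rfl (le_max_left _ (LG n)))
    ((hG n).mono le_rfl le_rfl (le_max_right (LF n) _))

end TwoFunction

/-! ### Rotation invariance of planar Gaussian processes -/

section PlanarProcess

variable {Ω S : Type*} [MeasurableSpace Ω] {P : Measure Ω} {X : S → Ω → ℂ} {K : S → S → ℝ}

lemma covariance_re_mul_re_mul [IsFiniteMeasure P] (hX : ∀ s, MemLp (X s) 2 P)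
    (hre : ∀ s t, cov[fun ω => (X s ω).re, fun ω => (X t ω).re; P] = K s t)
    (him : ∀ s t, cov[fun ω => (X s ω).im, fun ω => (X t ω).im; P] = K s t)
    (hri : ∀ s t, cov[fun ω => (X s ω).re, fun ω => (X t ω).im; P] = 0) (s t : S) (w w' : ℂ) :
    cov[fun ω => (w * X s ω).re, fun ω => (w' * X t ω).re; P]
      = (w * (starRingEnd ℂ) w').re * K s t := by
  have h1 : ∀ s (r : ℝ), MemLp (fun ω => r * (X s ω).re) 2 P := fun s r => (hX s).re.const_mul r
  have h2 : ∀ s (r : ℝ), MemLp (fun ω => r * (X s ω).im) 2 P := fun s r => (hX s).im.const_mul r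
  have hir : cov[fun ω => (X s ω).im, fun ω => (X t ω).re; P] = 0 := by
    rw [covariance_comm]; exact hri t s
  simp only [Complex.mul_re]
  rw [covariance_fun_sub_left (Z := fun ω => w'.re * (X t ω).re - w'.im * (X t ω).im)
      (h1 s _) (h2 s _) ((h1 t _).sub (h2 t _)),
    covariance_fun_sub_right (h1 s _) (h1 t _) (h2 t _),
    covariance_fun_sub_right (h2 s _) (h1 t _) (h2 t _)]
  simp only [covariance_const_mul_left, covariance_const_mul_right, hre, him, hri, hir,
    Complex.conj_re, Complex.conj_im]
  ring

lemma exists_forall_eq_sum_re {ι : Type*} [Fintype ι] (L : StrongDual ℝ (ι → ℂ)) :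
    ∃ w : ι → ℂ, ∀ v, L v = ∑ i, (w i * v i).re := by
  classical
  refine ⟨fun i => ⟨L (Pi.single i 1), -L (Pi.single i Complex.I)⟩, fun v => ?_⟩
  have hv : v = ∑ i, ((v i).re • (Pi.single i 1 : ι → ℂ)
      + (v i).im • (Pi.single i Complex.I : ι → ℂ)) := by
    ext j
    simp [Finset.sum_apply, Pi.single_apply, Finset.sum_add_distrib]
  conv_lhs => rw [hv]
  simp only [map_sum, map_add, map_smul, smul_eq_mul, Complex.mul_re]
  exact Finset.sum_congr rfl fun i _ => by ring

/-- The finite-dimensional laws of a centered planar Gaussian process whose two coordinates are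
uncorrelated with the same covariance are invariant under rotations of the plane. -/
lemma map_smul_eq_of_planar (hX : IsGaussianProcess X P) (hmean : ∀ s, ∫ ω, X s ω ∂P = 0)
    (hre : ∀ s t, cov[fun ω => (X s ω).re, fun ω => (X t ω).re; P] = K s t)
    (him : ∀ s t, cov[fun ω => (X s ω).im, fun ω => (X t ω).im; P] = K s t)
    (hri : ∀ s t, cov[fun ω => (X s ω).re, fun ω => (X t ω).im; P] = 0) (I : Finset S)
    {c : ℂ} (hc : ‖c‖ = 1) :
    (P.map fun ω => I.restrict (X · ω)).map (fun v => c • v) = P.map fun ω => I.restrict (X · ω) := by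
  have hP := hX.isProbabilityMeasure
  have hL := hX.hasGaussianLaw I
  have hG := hL.isGaussian_map
  have hX2 : ∀ s, MemLp (X s) 2 P := fun s => (hX.hasGaussianLaw_eval s).memLp_two
  have hmeas := hL.aemeasurable
  set γ := P.map fun ω => I.restrict (X · ω) with hγ
  have hγ0 : ∫ v, v ∂γ = 0 := by
    have hi : Integrable (fun v : I → ℂ => v) γ := IsGaussian.integrable_id
    ext i
    rw [eval_integral fun j => hi.eval j, integral_map hmeas
      (Continuous.aestronglyMeasurable (by fun_prop))]
    exact hmean i
  let R : (I → ℂ) →L[ℝ] (I → ℂ) := c • ContinuousLinearMap.id ℝ (I → ℂ)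
  have hR : γ.map (fun v => c • v) = γ.map R := rfl
  have hR0 : ∫ v, v ∂(γ.map R) = 0 := by
    rw [integral_map (by fun_prop) (by fun_prop)]
    exact (R.integral_comp_comm (φ := fun v => v) IsGaussian.integrable_id).trans (by simp [hγ0])
  -- Every real linear form is `v ↦ ∑ Re (w i * v i)`, and a centered Gaussian law is determined by
  -- the variances of such forms. This formula depends on `w` only through `w i * conj (w j)`, which
  -- is unchanged when `w` is replaced by `w * c`.
  have hvar : ∀ w : I → ℂ, Var[fun v : I → ℂ => ∑ i, (w i * v i).re; γ]
      = ∑ i, ∑ j, (w i * (starRingEnd ℂ) (w j)).re * K i j := by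
    intro w
    have hmL : ∀ i : I, MemLp (fun ω => (w i * X i ω).re) 2 P := fun i =>
      ((hX2 i).const_mul (w i)).re
    rw [hγ, variance_map (Continuous.aemeasurable (by fun_prop)) hmeas, ← covariance_self]
    · refine (covariance_fun_sum_fun_sum (X := fun (i : I) ω => (w i * X i ω).re)
        (Y := fun (i : I) ω => (w i * X i ω).re) hmL hmL).trans ?_
      exact Finset.sum_congr rfl fun i _ => Finset.sum_congr rfl fun j _ =>
        covariance_re_mul_re_mul hX2 hre him hri _ _ _ _
    · exact (Continuous.measurable (by fun_prop)).comp_aemeasurable hmeas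
  rw [hR]
  refine Measure.ext_of_charFunDual ?_
  ext L
  rw [IsGaussian.charFunDual_eq_of_integral_eq_zero (by simpa using hR0),
    IsGaussian.charFunDual_eq_of_integral_eq_zero (by simpa using hγ0),
    variance_map (by fun_prop) (by fun_prop)]
  obtain ⟨w, hw⟩ := exists_forall_eq_sum_re L
  have e1 : (L : (I → ℂ) → ℝ) = fun v => ∑ i, (w i * v i).re := funext hw
  have e2 : (L : (I → ℂ) → ℝ) ∘ R = fun v => ∑ i, ((w i * c) * v i).re := by
    ext v; simp [hw, R, mul_assoc]
  have hcc : c * (starRingEnd ℂ) c = 1 := by rw [Complex.mul_conj']; simp [hc]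
  rw [e2, e1, hvar, hvar]
  congr 4
  refine Finset.sum_congr rfl fun i _ => Finset.sum_congr rfl fun j _ => ?_
  rw [map_mul, mul_mul_mul_comm, hcc, mul_one]

end PlanarProcess

/-! ### Passage from finite-dimensional images to the whole space -/

section FiniteDimensionalApproximation

variable {B : Type*} [NormedAddCommGroup B] [NormedSpace ℝ B] [MeasurableSpace B] [BorelSpace B]
  {V : ℕ → Type*} [∀ n, NormedAddCommGroup (V n)] [∀ n, NormedSpace ℝ (V n)]
  [∀ n, MeasurableSpace (V n)] [∀ n, BorelSpace (V n)] [∀ n, FiniteDimensional ℝ (V n)]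
  {π : ∀ n, B →L[ℝ] V n} {s : ∀ n, V n → B} {μ : Measure B}

omit [∀ n, FiniteDimensional ℝ (V n)] in
-- For bounded continuous `f`, the functions `f ∘ s n ∘ π n` depend on finitely many coordinates in
-- the application and converge to `f` boundedly. Only continuity of `s n` is needed, not linearity.
lemma MeasureTheory.Measure.ext_of_tendsto_comp (hs : ∀ n, Continuous (s n))
    (hlim : ∀ x, Filter.Tendsto (fun n => s n (π n x)) Filter.atTop (nhds x)) {ν : Measure B}
    [IsFiniteMeasure μ] [IsFiniteMeasure ν] (h : ∀ n, μ.map (π n) = ν.map (π n)) : μ = ν := by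
  refine ext_of_forall_integral_eq_of_IsFiniteMeasure fun f => ?_
  have key : ∀ m : Measure B, IsFiniteMeasure m →
      Filter.Tendsto (fun n => ∫ x, f (s n (π n x)) ∂m) Filter.atTop (nhds (∫ x, f x ∂m)) := by
    intro m _
    refine tendsto_integral_of_dominated_convergence (fun _ => ‖f‖) (fun n => ?_)
      (integrable_const _) (fun n => Filter.Eventually.of_forall fun x => f.norm_coe_le_norm _)
      (Filter.Eventually.of_forall fun x => (f.continuous.tendsto x).comp (hlim x))
    exact ((f.continuous.comp (hs n)).comp (π n).continuous).measurable.aestronglyMeasurable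
  have h1 := key μ inferInstance
  have e : ∀ n, ∫ x, f (s n (π n x)) ∂μ = ∫ x, f (s n (π n x)) ∂ν := by
    intro n
    have hc : StronglyMeasurable fun v => f (s n v) :=
      (f.continuous.comp (hs n)).measurable.stronglyMeasurable
    have e1 := fun m : Measure B => integral_map (μ := m) (π n).continuous.measurable.aemeasurable
      hc.aestronglyMeasurable
    rw [← e1, ← e1, h]
  simp_rw [e] at h1
  exact tendsto_nhds_unique h1 (key ν inferInstance)

variable [SecondCountableTopology B] [IsProbabilityMeasure μ]

lemma map_smul_add_smul_of_tendsto_comp (hs : ∀ n, Continuous (s n))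
    (hlim : ∀ x, Filter.Tendsto (fun n => s n (π n x)) Filter.atTop (nhds x))
    (hG : ∀ n, IsGaussian (μ.map (π n))) (h0 : ∀ n, ∫ v, v ∂(μ.map (π n)) = 0) {a b : ℝ}
    (hab : a ^ 2 + b ^ 2 = 1) : (μ.prod μ).map (fun z : B × B => a • z.1 + b • z.2) = μ := by
  have : IsProbabilityMeasure ((μ.prod μ).map (fun z : B × B => a • z.1 + b • z.2)) :=
    Measure.isProbabilityMeasure_map (by fun_prop)
  refine Measure.ext_of_tendsto_comp hs hlim fun n => ?_
  have := hG n
  have : ProperSpace (V n) := FiniteDimensional.proper ℝ (V n)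
  have : CompleteSpace (V n) := FiniteDimensional.complete ℝ (V n)
  have hm : Measurable (π n) := (π n).continuous.measurable
  rw [Measure.map_map hm (by fun_prop)]
  conv_rhs => rw [← IsGaussian.map_smul_add_smul (h0 n) hab]
  rw [Measure.map_prod_map _ _ hm hm, Measure.map_map (by fun_prop) (hm.prodMap hm)]
  congr 1
  ext z
  simp

/-- Since `π n` is linear, it maps the correlated pair of `μ` to the correlated pair of the Gaussian
image; the inequality there, applied to `f ∘ s n` and `g ∘ s n`, passes to the limit. -/
lemma integral_rpow_mul_rpow_corrPair_le_of_tendsto_comp (hs : ∀ n, Continuous (s n))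
    (hlim : ∀ x, Filter.Tendsto (fun n => s n (π n x)) Filter.atTop (nhds x))
    (hG : ∀ n, IsGaussian (μ.map (π n))) (h0 : ∀ n, ∫ v, v ∂(μ.map (π n)) = 0) {ρ σ α β C : ℝ}
    (h : ρ ^ 2 + σ ^ 2 = 1) (hα : α ∈ Set.Ioo (0 : ℝ) 1) (hβ : β ∈ Set.Ioo (0 : ℝ) 1)
    (hρ : ρ ^ 2 * (α * β) ≤ (1 - α) * (1 - β)) {f g : B → ℝ}
    (hf : Continuous f) (hg : Continuous g) (hfC : ∀ x, f x ∈ Set.Icc 0 C)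
    (hgC : ∀ x, g x ∈ Set.Icc 0 C) :
    ∫ z, f z.1 ^ α * g z.2 ^ β ∂(corrPair μ ρ σ) ≤ (∫ x, f x ∂μ) ^ α * (∫ x, g x ∂μ) ^ β := by
  refine integral_rpow_mul_rpow_le_of_tendsto (C := C) (F := fun n x => f (s n (π n x)))
    (G := fun n x => g (s n (π n x))) hα.1.le hβ.1.le
    (fun n => (hf.comp (hs n)).comp (π n).continuous)
    (fun n => (hg.comp (hs n)).comp (π n).continuous) (fun n x => hfC _) (fun n x => hgC _)
    (fun x => (hf.tendsto x).comp (hlim x)) (fun x => (hg.tendsto x).comp (hlim x)) fun n => ?_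
  have := hG n
  have : ProperSpace (V n) := FiniteDimensional.proper ℝ (V n)
  have hm : Measurable (π n) := (π n).continuous.measurable
  have hcorr : (corrPair μ ρ σ).map (Prod.map (π n) (π n)) = corrPair (μ.map (π n)) ρ σ := by
    rw [corrPair, corrPair, Measure.map_map (hm.prodMap hm) (by fun_prop),
      Measure.map_prod_map _ _ hm hm, Measure.map_map (by fun_prop) (hm.prodMap hm)]
    congr 1
    ext z <;> simp
  have hfs : Continuous fun v => f (s n v) := hf.comp (hs n)
  have hgs : Continuous fun v => g (s n v) := hg.comp (hs n)
  have := integral_rpow_mul_rpow_corrPair_le (h0 n) h hα hβ hρ hfs hgs (fun v => hfC _)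
    (fun v => hgC _)
  rw [← hcorr, integral_map (hm.prodMap hm).aemeasurable (Continuous.aestronglyMeasurable ?_),
    integral_map hm.aemeasurable hfs.aestronglyMeasurable,
    integral_map hm.aemeasurable hgs.aestronglyMeasurable] at this
  · exact this
  · exact ((hfs.comp continuous_fst).rpow_const fun _ => Or.inr hα.1.le).mul
      ((hgs.comp continuous_snd).rpow_const fun _ => Or.inr hβ.1.le)

end FiniteDimensionalApproximation

/-! ### Nelson's hypercontractivity -/

section Hypercontractivity

variable {B : Type*} [NormedAddCommGroup B] [NormedSpace ℝ B] [MeasurableSpace B] [BorelSpace B]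
  [SecondCountableTopology B] {μ : Measure B} [IsProbabilityMeasure μ] {ρ σ p q : ℝ}

/-- Hypercontractivity for bounded continuous functions, from the two-function inequality by
duality. -/
lemma integral_rpow_le_of_twoFunction (hp : 1 < p) (hq : 1 < q)
    (H : ∀ (C : ℝ) (f g : B → ℝ), Continuous f → Continuous g → (∀ x, f x ∈ Set.Icc 0 C) →
      (∀ x, g x ∈ Set.Icc 0 C) → ∫ z, f z.1 ^ (1 - 1 / q) * g z.2 ^ (1 / p) ∂(corrPair μ ρ σ)
        ≤ (∫ x, f x ∂μ) ^ (1 - 1 / q) * (∫ x, g x ∂μ) ^ (1 / p))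
    {f : B → ℝ} (hf : Continuous f) {C : ℝ} (hC : ∀ x, f x ∈ Set.Icc 0 C) :
    ∫ x, (∫ y, f (ρ • x + σ • y) ∂μ) ^ q ∂μ ≤ (∫ x, f x ^ p ∂μ) ^ (q / p) := by
  have hp0 : 0 < p := by linarith
  have hq0 : 0 < q := by linarith
  set g : B → ℝ := fun x => ∫ y, f (ρ • x + σ • y) ∂μ with hg
  have habs : ∀ x, |f x| ≤ C := fun x => by rw [abs_of_nonneg (hC x).1]; exact (hC x).2
  have hgc : Continuous g := by
    refine continuous_of_dominated (bound := fun _ => C)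
      (fun x => Continuous.aestronglyMeasurable (by fun_prop)) (fun x => ?_)
      (integrable_const C) ?_
    · exact Filter.Eventually.of_forall fun y => habs _
    · exact Filter.Eventually.of_forall fun y => by fun_prop
  have hg0 : ∀ x, g x ∈ Set.Icc 0 C := fun x => by
    refine ⟨integral_nonneg fun y => (hC _).1, ?_⟩
    have := integral_mono (μ := μ) (Continuous.integrable_of_bounded'
      (by fun_prop : Continuous fun y => f (ρ • x + σ • y)) fun y => habs _)
      (integrable_const C) fun y => (hC _).2
    simpa using this
  have hC0 : 0 ≤ C := (hC 0).1.trans (hC 0).2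
  have hpow : ∀ {u : B → ℝ}, (∀ x, u x ∈ Set.Icc 0 C) → ∀ {r : ℝ}, 0 ≤ r → ∀ D, C ^ r ≤ D → ∀ x,
      u x ^ r ∈ Set.Icc 0 D := fun hu r hr D hD x =>
    ⟨Real.rpow_nonneg (hu x).1 _, (Real.rpow_le_rpow (hu x).1 (hu x).2 hr).trans hD⟩
  -- The dual function is the extremal one, `g^(q - 1)`, written as `(g^q)^(1 - 1/q)`; likewise `f =
  -- (f^p)^(1/p)`. The maximum is a common bound for `g^q` and `f^p`.
  have key := H (max (C ^ q) (C ^ p)) (fun x => g x ^ q) (fun x => f x ^ p)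
    (hgc.rpow_const fun _ => Or.inr hq0.le) (hf.rpow_const fun _ => Or.inr hp0.le)
    (hpow hg0 hq0.le _ (le_max_left _ _)) (hpow hC hp0.le _ (le_max_right _ _))
  have e1 : ∀ z : B × B, (g z.1 ^ q) ^ (1 - 1 / q) * (f z.2 ^ p) ^ (1 / p)
      = g z.1 ^ (q - 1) * f z.2 := fun z => by
    rw [← Real.rpow_mul (hg0 _).1, ← Real.rpow_mul (hC _).1, mul_one_div_cancel hp0.ne',
      Real.rpow_one, mul_sub, mul_one, mul_one_div_cancel hq0.ne']
  simp only [e1] at key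
  have hgq : Continuous fun x => g x ^ (q - 1) := hgc.rpow_const fun _ => Or.inr (by linarith)
  have hcont : Continuous fun z : B × B => g z.1 ^ (q - 1) * f z.2 :=
    (hgq.comp continuous_fst).mul (hf.comp continuous_snd)
  have hcont' : Continuous fun z : B × B => g z.1 ^ (q - 1) * f (ρ • z.1 + σ • z.2) :=
    (hgq.comp continuous_fst).mul (hf.comp (by fun_prop))
  have e2 : ∫ z, g z.1 ^ (q - 1) * f z.2 ∂(corrPair μ ρ σ) = ∫ x, g x ^ q ∂μ := by
    rw [corrPair, integral_map (by fun_prop) hcont.aestronglyMeasurable, integral_prod]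
    · refine integral_congr_ae (Filter.Eventually.of_forall fun x => ?_)
      simp only
      rw [integral_const_mul]
      change g x ^ (q - 1) * g x = _
      rcases (hg0 x).1.eq_or_lt with h | h
      · rw [← h, mul_zero, Real.zero_rpow hq0.ne']
      · rw [Real.rpow_sub_one h.ne', div_mul_cancel₀ _ h.ne']
    · refine Continuous.integrable_of_bounded' (C := C ^ (q - 1) * C) hcont' fun z => ?_
      rw [abs_mul]
      have h1 := hpow hg0 (r := q - 1) (by linarith) _ le_rfl z.1
      rw [abs_of_nonneg h1.1]
      exact mul_le_mul h1.2 (habs _) (abs_nonneg _) (Real.rpow_nonneg hC0 _)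
  rw [e2] at key
  set A := ∫ x, g x ^ q ∂μ
  have hA : 0 ≤ A := integral_nonneg fun x => Real.rpow_nonneg (hg0 x).1 _
  set D := ∫ x, f x ^ p ∂μ
  have hD : 0 ≤ D := integral_nonneg fun x => Real.rpow_nonneg (hC x).1 _
  -- The inequality reads `A ≤ A^(1 - 1/q) D^(1/p)`; the power of `A` can be cancelled only when `A`
  -- is positive.
  rcases hA.eq_or_lt with h | h
  · rw [← h]; exact Real.rpow_nonneg hD _
  · have h1 : A ^ (1 / q) ≤ D ^ (1 / p) := by
      have h2 : A = A ^ (1 - 1 / q) * A ^ (1 / q) := by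
        rw [← Real.rpow_add h]; simp
      have h3 : 0 < A ^ (1 - 1 / q) := Real.rpow_pos_of_pos h _
      exact le_of_mul_le_mul_left (h2.symm.trans_le key) h3
    calc A = (A ^ (1 / q)) ^ q := by
          rw [← Real.rpow_mul hA, one_div_mul_cancel hq0.ne', Real.rpow_one]
      _ ≤ (D ^ (1 / p)) ^ q := Real.rpow_le_rpow (Real.rpow_nonneg hA _) h1 hq0.le
      _ = D ^ (q / p) := by rw [← Real.rpow_mul hD]; congr 1; ring

omit [SecondCountableTopology B] in
/-- Hypercontractivity in lower-integral form for bounded continuous functions. -/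
lemma lintegral_rpow_enorm_le_of_integral (hp : 1 < p) (hq : 1 < q)
    (H : ∀ (C : ℝ) (f : B → ℝ), Continuous f → (∀ x, f x ∈ Set.Icc 0 C) →
      ∫ x, (∫ y, f (ρ • x + σ • y) ∂μ) ^ q ∂μ ≤ (∫ x, f x ^ p ∂μ) ^ (q / p))
    (G : BoundedContinuousFunction B ℂ) :
    ∫⁻ x, (∫⁻ y, ‖G (ρ • x + σ • y)‖ₑ ∂μ) ^ q ∂μ ≤ eLpNorm G (ENNReal.ofReal p) μ ^ q := by
  have hp0 : 0 < p := by linarith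
  have hq0 : 0 < q := by linarith
  have hGc : Continuous G := G.continuous
  have hG : ∀ x, ‖G x‖ ∈ Set.Icc 0 ‖G‖ := fun x => ⟨norm_nonneg _, G.norm_coe_le_norm x⟩
  have key := H ‖G‖ (fun x => ‖G x‖) hGc.norm hG
  have hi : ∀ x, Integrable (fun y => ‖G (ρ • x + σ • y)‖) μ := fun x =>
    Continuous.integrable_of_bounded' (C := ‖G‖) (by fun_prop) fun y => by
      rw [abs_norm]; exact G.norm_coe_le_norm _
  have e1 : ∀ x, ∫⁻ y, ‖G (ρ • x + σ • y)‖ₑ ∂μ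
      = ENNReal.ofReal (∫ y, ‖G (ρ • x + σ • y)‖ ∂μ) := fun x => by
    rw [ofReal_integral_eq_lintegral_ofReal (hi x)
      (Filter.Eventually.of_forall fun y => norm_nonneg _)]
    simp_rw [ofReal_norm]
  have h0 : ∀ x, 0 ≤ ∫ y, ‖G (ρ • x + σ • y)‖ ∂μ := fun x => integral_nonneg fun y => norm_nonneg _
  have hle : ∀ x, ∫ y, ‖G (ρ • x + σ • y)‖ ∂μ ≤ ‖G‖ := fun x => by
    have := integral_mono (hi x) (integrable_const ‖G‖) fun y => G.norm_coe_le_norm _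
    simpa using this
  have hgc : Continuous fun x => ∫ y, ‖G (ρ • x + σ • y)‖ ∂μ := by
    refine continuous_of_dominated (bound := fun _ => ‖G‖)
      (fun x => Continuous.aestronglyMeasurable (by fun_prop)) (fun x => ?_)
      (integrable_const _) ?_
    · exact Filter.Eventually.of_forall fun y => by
        rw [norm_norm]; exact G.norm_coe_le_norm _
    · exact Filter.Eventually.of_forall fun y => by fun_prop
  have e2 : ∫⁻ x, (∫⁻ y, ‖G (ρ • x + σ • y)‖ₑ ∂μ) ^ q ∂μ
      = ENNReal.ofReal (∫ x, (∫ y, ‖G (ρ • x + σ • y)‖ ∂μ) ^ q ∂μ) := by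
    rw [ofReal_integral_eq_lintegral_ofReal]
    · refine lintegral_congr fun x => ?_
      rw [e1, ENNReal.ofReal_rpow_of_nonneg (h0 x) hq0.le]
    · refine Continuous.integrable_of_bounded' (C := ‖G‖ ^ q)
        (hgc.rpow_const fun _ => Or.inr hq0.le) fun x => ?_
      rw [abs_of_nonneg (Real.rpow_nonneg (h0 x) _)]
      exact Real.rpow_le_rpow (h0 x) (hle x) hq0.le
    · exact Filter.Eventually.of_forall fun x => Real.rpow_nonneg (h0 x) _
  have e3 : ENNReal.ofReal (∫ x, ‖G x‖ ^ p ∂μ) = ∫⁻ x, ‖G x‖ₑ ^ p ∂μ := by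
    rw [ofReal_integral_eq_lintegral_ofReal]
    · refine lintegral_congr fun x => ?_
      rw [← ENNReal.ofReal_rpow_of_nonneg (norm_nonneg _) hp0.le, ofReal_norm]
    · refine Continuous.integrable_of_bounded' (C := ‖G‖ ^ p)
        (hGc.norm.rpow_const fun _ => Or.inr hp0.le) fun x => ?_
      rw [abs_of_nonneg (Real.rpow_nonneg (norm_nonneg _) _)]
      exact Real.rpow_le_rpow (norm_nonneg _) (G.norm_coe_le_norm x) hp0.le
    · exact Filter.Eventually.of_forall fun x => Real.rpow_nonneg (norm_nonneg _) _
  have hI : 0 ≤ ∫ x, ‖G x‖ ^ p ∂μ := integral_nonneg fun x => Real.rpow_nonneg (norm_nonneg _) _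
  rw [e2, eLpNorm_eq_lintegral_rpow_enorm_toReal (by simpa using hp0) ENNReal.ofReal_ne_top,
    ENNReal.toReal_ofReal hp0.le, ← e3, ← ENNReal.rpow_mul, one_div_mul_eq_div,
    ENNReal.ofReal_rpow_of_nonneg hI (by positivity)]
  exact ENNReal.ofReal_le_ofReal key

/-- Hypercontractivity extends from bounded continuous functions to `L^p` by Fatou's lemma. -/
lemma lintegral_rpow_enorm_le_of_boundedContinuous (hp : 1 < p) (hq : 1 < q)
    (hst : (μ.prod μ).map (fun z : B × B => ρ • z.1 + σ • z.2) = μ)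
    (H : ∀ G : BoundedContinuousFunction B ℂ,
      ∫⁻ x, (∫⁻ y, ‖G (ρ • x + σ • y)‖ₑ ∂μ) ^ q ∂μ ≤ eLpNorm G (ENNReal.ofReal p) μ ^ q)
    {F : B → ℂ} (hF : MemLp F (ENNReal.ofReal p) μ) :
    ∫⁻ x, (∫⁻ y, ‖F (ρ • x + σ • y)‖ₑ ∂μ) ^ q ∂μ ≤ eLpNorm F (ENNReal.ofReal p) μ ^ q := by
  have hq0 : 0 < q := by linarith
  have hp1 : (1 : ENNReal) ≤ ENNReal.ofReal p := by
    rw [← ENNReal.ofReal_one]; exact ENNReal.ofReal_le_ofReal hp.le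
  have hp0 : ENNReal.ofReal p ≠ 0 := (zero_lt_one.trans_le hp1).ne'
  choose G hG hGm using fun n : ℕ => hF.exists_boundedContinuous_eLpNorm_sub_le
    ENNReal.ofReal_ne_top (ε := ((n : ENNReal) + 1)⁻¹) (by simp)
  have hlim0 : Filter.Tendsto (fun n : ℕ => ((n : ENNReal) + 1)⁻¹) Filter.atTop (nhds 0) := by
    have := (Filter.tendsto_add_atTop_iff_nat 1).2 ENNReal.tendsto_inv_nat_nhds_zero
    simpa using this
  have hlim : Filter.Tendsto (fun n => eLpNorm (⇑(G n) - F) (ENNReal.ofReal p) μ) Filter.atTop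
      (nhds 0) := by
    refine tendsto_of_tendsto_of_tendsto_of_le_of_le tendsto_const_nhds hlim0
      (fun n => zero_le) fun n => ?_
    simp only
    rw [eLpNorm_sub_comm]
    exact hG n
  obtain ⟨φ, hφ, hae⟩ := (tendstoInMeasure_of_tendsto_eLpNorm hp0
    (fun n => (hGm n).1) hF.1 hlim).exists_seq_tendsto_ae
  have hΦ : Measurable (fun z : B × B => ρ • z.1 + σ • z.2) := by fun_prop
  have hae2 : ∀ᵐ x ∂μ, ∀ᵐ y ∂μ, Filter.Tendsto (fun n => G (φ n) (ρ • x + σ • y)) Filter.atTop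
      (nhds (F (ρ • x + σ • y))) := by
    refine Measure.ae_ae_of_ae_prod (p := fun z : B × B => Filter.Tendsto
      (fun n => G (φ n) (ρ • z.1 + σ • z.2)) Filter.atTop (nhds (F (ρ • z.1 + σ • z.2)))) ?_
    -- Since `ρ x + σ y` has law `μ`, almost sure convergence under `μ` transfers to almost every
    -- pair `(x, y)`.
    rw [← hst] at hae
    exact ae_of_ae_map hΦ.aemeasurable hae
  have hmeas : ∀ n x, AEMeasurable (fun y => ‖G (φ n) (ρ • x + σ • y)‖ₑ) μ := fun n x => by
    have := (G (φ n)).continuous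
    exact Continuous.aemeasurable (by fun_prop)
  have hfatou : ∀ᵐ x ∂μ, (∫⁻ y, ‖F (ρ • x + σ • y)‖ₑ ∂μ) ^ q
      ≤ Filter.liminf (fun n => (∫⁻ y, ‖G (φ n) (ρ • x + σ • y)‖ₑ ∂μ) ^ q) Filter.atTop := by
    filter_upwards [hae2] with x hx
    have h1 : ∫⁻ y, ‖F (ρ • x + σ • y)‖ₑ ∂μ
        ≤ Filter.liminf (fun n => ∫⁻ y, ‖G (φ n) (ρ • x + σ • y)‖ₑ ∂μ) Filter.atTop := by
      calc ∫⁻ y, ‖F (ρ • x + σ • y)‖ₑ ∂μ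
          = ∫⁻ y, Filter.liminf (fun n => ‖G (φ n) (ρ • x + σ • y)‖ₑ) Filter.atTop ∂μ := by
            refine lintegral_congr_ae ?_
            filter_upwards [hx] with y hy
            exact hy.enorm.liminf_eq.symm
        _ ≤ _ := lintegral_liminf_le' fun n => hmeas n x
    refine (ENNReal.rpow_le_rpow h1 hq0.le).trans_eq ?_
    exact (ENNReal.orderIsoRpow q hq0).liminf_apply
  have hnorm : Filter.Tendsto (fun n => eLpNorm (G (φ n)) (ENNReal.ofReal p) μ ^ q) Filter.atTop
      (nhds (eLpNorm F (ENNReal.ofReal p) μ ^ q)) := by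
    refine (ENNReal.continuous_rpow_const (y := q)).continuousAt.tendsto.comp ?_
    refine Filter.Tendsto.comp (g := fun n => eLpNorm (G n) (ENNReal.ofReal p) μ) ?_
      hφ.tendsto_atTop
    have hu : Filter.Tendsto (fun n : ℕ => eLpNorm F (ENNReal.ofReal p) μ + ((n : ENNReal) + 1)⁻¹)
        Filter.atTop (nhds (eLpNorm F (ENNReal.ofReal p) μ)) := by
      simpa using hlim0.const_add (eLpNorm F (ENNReal.ofReal p) μ)
    have hl : Filter.Tendsto (fun n : ℕ => eLpNorm F (ENNReal.ofReal p) μ - ((n : ENNReal) + 1)⁻¹)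
        Filter.atTop (nhds (eLpNorm F (ENNReal.ofReal p) μ)) := by
      simpa using ENNReal.Tendsto.sub (tendsto_const_nhds (x := eLpNorm F (ENNReal.ofReal p) μ))
        hlim0 (Or.inl hF.2.ne)
    refine tendsto_of_tendsto_of_tendsto_of_le_of_le hl hu (fun n => ?_) fun n => ?_
    · rw [tsub_le_iff_right]
      have := eLpNorm_add_le (hF.1.sub (hGm n).1) (hGm n).1 hp1
      rw [sub_add_cancel, add_comm] at this
      exact this.trans (by gcongr; exact hG n)
    · have := eLpNorm_add_le ((hGm n).1.sub hF.1) hF.1 hp1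
      rw [sub_add_cancel, add_comm, eLpNorm_sub_comm] at this
      exact this.trans (by gcongr; exact hG n)
  calc ∫⁻ x, (∫⁻ y, ‖F (ρ • x + σ • y)‖ₑ ∂μ) ^ q ∂μ
      ≤ ∫⁻ x, Filter.liminf (fun n => (∫⁻ y, ‖G (φ n) (ρ • x + σ • y)‖ₑ ∂μ) ^ q) Filter.atTop ∂μ :=
        lintegral_mono_ae hfatou
    _ ≤ Filter.liminf (fun n => ∫⁻ x, (∫⁻ y, ‖G (φ n) (ρ • x + σ • y)‖ₑ ∂μ) ^ q ∂μ)
        Filter.atTop := by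
        refine lintegral_liminf_le' fun n => ?_
        have hc := (G (φ n)).continuous
        have : Measurable (fun z : B × B => ‖G (φ n) (ρ • z.1 + σ • z.2)‖ₑ) :=
          Continuous.measurable (by fun_prop)
        exact (this.lintegral_prod_right'.pow_const q).aemeasurable
    _ ≤ Filter.liminf (fun n => eLpNorm (G (φ n)) (ENNReal.ofReal p) μ ^ q) Filter.atTop :=
        Filter.liminf_le_liminf (Filter.Eventually.of_forall fun n => H (G (φ n)))
    _ = _ := hnorm.liminf_eq

/-- Absolute convergence comes from Fubini: `F (ρ x + σ y)` is integrable over the product because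
`ρ x + σ y` has law `μ` and `L^p ⊆ L^1`. The norm bound comes from moving the norm inside the inner
integral. -/
lemma memLp_and_eLpNorm_le_of_boundedContinuous (hp : 1 < p) (hq : 1 < q)
    (hst : (μ.prod μ).map (fun z : B × B => ρ • z.1 + σ • z.2) = μ)
    (H : ∀ G : BoundedContinuousFunction B ℂ,
      ∫⁻ x, (∫⁻ y, ‖G (ρ • x + σ • y)‖ₑ ∂μ) ^ q ∂μ ≤ eLpNorm G (ENNReal.ofReal p) μ ^ q)
    {F : B → ℂ} (hF : MemLp F (ENNReal.ofReal p) μ) :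
    (∀ᵐ x ∂μ, Integrable (fun y => F (ρ • x + σ • y)) μ) ∧
      MemLp (fun x => ∫ y, F (ρ • x + σ • y) ∂μ) (ENNReal.ofReal q) μ ∧
      eLpNorm (fun x => ∫ y, F (ρ • x + σ • y) ∂μ) (ENNReal.ofReal q) μ
        ≤ eLpNorm F (ENNReal.ofReal p) μ := by
  have hq0 : 0 < q := by linarith
  have hp1 : (1 : ENNReal) ≤ ENNReal.ofReal p := by
    rw [← ENNReal.ofReal_one]; exact ENNReal.ofReal_le_ofReal hp.le
  have hmp : MeasurePreserving (fun z : B × B => ρ • z.1 + σ • z.2) (μ.prod μ) μ :=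
    ⟨by fun_prop, hst⟩
  have hint : Integrable (fun z : B × B => F (ρ • z.1 + σ • z.2)) (μ.prod μ) :=
    hmp.integrable_comp_of_integrable (hF.integrable hp1)
  have hle : eLpNorm (fun x => ∫ y, F (ρ • x + σ • y) ∂μ) (ENNReal.ofReal q) μ
        ≤ eLpNorm F (ENNReal.ofReal p) μ := by
    have h1 := lintegral_rpow_enorm_le_of_boundedContinuous hp hq hst H hF
    rw [eLpNorm_eq_lintegral_rpow_enorm_toReal (by simpa using hq0) ENNReal.ofReal_ne_top,
      ENNReal.toReal_ofReal hq0.le]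
    calc (∫⁻ x, ‖∫ y, F (ρ • x + σ • y) ∂μ‖ₑ ^ q ∂μ) ^ (1 / q)
        ≤ (∫⁻ x, (∫⁻ y, ‖F (ρ • x + σ • y)‖ₑ ∂μ) ^ q ∂μ) ^ (1 / q) := by
          gcongr
          exact enorm_integral_le_lintegral_enorm _
      _ ≤ (eLpNorm F (ENNReal.ofReal p) μ ^ q) ^ (1 / q) := by gcongr
      _ = _ := by rw [← ENNReal.rpow_mul, mul_one_div_cancel hq0.ne', ENNReal.rpow_one]
  exact ⟨hint.prod_right_ae, ⟨hint.1.integral_prod_right', hle.trans_lt hF.2⟩, hle⟩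

variable {V : ℕ → Type*} [∀ n, NormedAddCommGroup (V n)] [∀ n, NormedSpace ℝ (V n)]
  [∀ n, MeasurableSpace (V n)] [∀ n, BorelSpace (V n)] [∀ n, FiniteDimensional ℝ (V n)]
  {π : ∀ n, B →L[ℝ] V n} {s : ∀ n, V n → B}

/-- **Nelson's hypercontractivity** for the symmetric Ornstein–Uhlenbeck operators of a measure
with centered Gaussian finite-dimensional images. -/
lemma memLp_and_eLpNorm_le_of_tendsto_comp (hs : ∀ n, Continuous (s n))
    (hlim : ∀ x, Filter.Tendsto (fun n => s n (π n x)) Filter.atTop (nhds x))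
    (hG : ∀ n, IsGaussian (μ.map (π n))) (h0 : ∀ n, ∫ v, v ∂(μ.map (π n)) = 0)
    (h : ρ ^ 2 + σ ^ 2 = 1) (hp : 1 < p) (hq : 1 < q) (hρ : ρ ^ 2 * (q - 1) ≤ p - 1)
    {F : B → ℂ} (hF : MemLp F (ENNReal.ofReal p) μ) :
    (∀ᵐ x ∂μ, Integrable (fun y => F (ρ • x + σ • y)) μ) ∧
      MemLp (fun x => ∫ y, F (ρ • x + σ • y) ∂μ) (ENNReal.ofReal q) μ ∧
      eLpNorm (fun x => ∫ y, F (ρ • x + σ • y) ∂μ) (ENNReal.ofReal q) μ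
        ≤ eLpNorm F (ENNReal.ofReal p) μ := by
  have hp0 : 0 < p := by linarith
  have hq0 : 0 < q := by linarith
  have hα : 1 - 1 / q ∈ Set.Ioo (0 : ℝ) 1 :=
    ⟨by rw [sub_pos, div_lt_one hq0]; exact hq, by rw [sub_lt_self_iff]; positivity⟩
  have hβ : 1 / p ∈ Set.Ioo (0 : ℝ) 1 := ⟨by positivity, by rw [div_lt_one hp0]; exact hp⟩
  have hαβ : ρ ^ 2 * ((1 - 1 / q) * (1 / p)) ≤ (1 - (1 - 1 / q)) * (1 - 1 / p) := by
    have e1 : ρ ^ 2 * ((1 - 1 / q) * (1 / p)) = ρ ^ 2 * (q - 1) / (q * p) := by field_simp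
    have e2 : (1 - (1 - 1 / q)) * (1 - 1 / p) = (p - 1) / (q * p) := by field_simp; ring
    rw [e1, e2]
    gcongr
  refine memLp_and_eLpNorm_le_of_boundedContinuous hp hq
    (map_smul_add_smul_of_tendsto_comp hs hlim hG h0 h) ?_ hF
  refine lintegral_rpow_enorm_le_of_integral hp hq fun C f hf hC => ?_
  refine integral_rpow_le_of_twoFunction hp hq (fun C f g hf hg hfC hgC => ?_) hf hC
  exact integral_rpow_mul_rpow_corrPair_le_of_tendsto_comp hs hlim hG h0 h hα hβ hαβ hf hg hfC hgC

end Hypercontractivity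

/-! ### The path space and the Wiener measure -/

section PathSpace

variable {T : ℝ}

instance instSecondCountableTopologyPathSpace (T : ℝ) : SecondCountableTopology (PathSpace T) :=
  TopologicalSpace.Subtype.secondCountableTopology _

/-- The values of a path at finitely many times. -/
noncomputable def pathEval (I : Finset (Set.Icc (0 : ℝ) T)) : PathSpace T →L[ℝ] (I → ℂ) where
  toFun x i := x.1 i
  map_add' _ _ := rfl
  map_smul' _ _ := rfl
  cont := continuous_pi fun i => (continuous_eval_const (i : Set.Icc (0 : ℝ) T)).comp
    continuous_subtype_val

/-- Paths are recovered as limits of functions of finitely many of their values. -/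
lemma exists_tendsto_comp_pathEval (hT : 0 < T) :
    ∃ (I : ℕ → Finset (Set.Icc (0 : ℝ) T)) (s : ∀ n, (I n → ℂ) → PathSpace T),
      (∀ n, Continuous (s n)) ∧
      ∀ x, Filter.Tendsto (fun n => s n (pathEval (I n) x)) Filter.atTop (nhds x) := by
  classical
  let φ : C(Set.Icc (0 : ℝ) T, unitInterval) :=
    ⟨fun r => ⟨r / T, div_nonneg r.2.1 hT.le, (div_le_one hT).2 r.2.2⟩, by fun_prop⟩
  let ψ : C(unitInterval, Set.Icc (0 : ℝ) T) :=
    ⟨fun u => ⟨u * T, mul_nonneg u.2.1 hT.le, mul_le_of_le_one_left hT.le u.2.2⟩, by fun_prop⟩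
  have hψφ : ∀ r, ψ (φ r) = r := fun r => Subtype.ext (div_mul_cancel₀ (r : ℝ) hT.ne')
  let t : ∀ n : ℕ, Fin (n + 1) → Set.Icc (0 : ℝ) T := fun n k => ψ (bernstein.z k)
  let I : ℕ → Finset (Set.Icc (0 : ℝ) T) := fun n => Finset.univ.image (t n)
  have htI : ∀ n k, t n k ∈ I n := fun n k => Finset.mem_image_of_mem _ (Finset.mem_univ k)
  let β : ∀ n : ℕ, Fin (n + 1) → C(Set.Icc (0 : ℝ) T, ℂ) := fun n k =>
    ⟨fun r => ((bernstein n k (φ r) : ℝ) : ℂ), by fun_prop⟩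
  have hβ : ∀ n k r, β n k r = ((bernstein n k (φ r) : ℝ) : ℂ) := fun _ _ _ => rfl
  have ht0 : ∀ n, ((t n 0 : Set.Icc (0 : ℝ) T) : ℝ) = 0 := fun n => by
    simp [t, ψ]
  -- Only the Bernstein polynomial with `k = 0` is nonzero at time `0`. Subtracting the value at
  -- time `0` cancels its coefficient, so that arbitrary data `v` yield a path in the subspace; for
  -- the values of an actual path the correction is zero.
  have hmem : ∀ n (v : I n → ℂ), ∑ k, (v ⟨t n k, htI n k⟩ - v ⟨t n 0, htI n 0⟩) • β n k
      ∈ pathSubmodule T := by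
    intro n v r hr
    rw [ContinuousMap.sum_apply]
    refine Finset.sum_eq_zero fun k _ => ?_
    rcases eq_or_ne k 0 with rfl | hk
    · rw [ContinuousMap.smul_apply, sub_self, zero_smul]
    · have hk0 : (k : ℕ) ≠ 0 := fun h => hk (Fin.ext h)
      have hφ : ((φ r : unitInterval) : ℝ) = 0 := by
        change (r : ℝ) / T = 0
        rw [hr, zero_div]
      rw [ContinuousMap.smul_apply, hβ, bernstein_apply, hφ, zero_pow hk0, mul_zero, zero_mul,
        Complex.ofReal_zero, smul_zero]
  refine ⟨I, fun n v => ⟨_, hmem n v⟩, fun n => ?_, fun x => ?_⟩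
  · refine Continuous.subtype_mk ?_ _
    exact continuous_finsetSum _ fun k _ =>
      (show Continuous fun v : I n → ℂ => v ⟨t n k, htI n k⟩ - v ⟨t n 0, htI n 0⟩ by fun_prop).smul
        continuous_const
  · rw [tendsto_subtype_rng]
    have h1 := (ContinuousMap.continuous_precomp φ).tendsto _ |>.comp
      (bernsteinApproximation_uniform (x.1.comp ψ))
    have h2 : (x.1.comp ψ).comp φ = x.1 := by
      ext r
      rw [ContinuousMap.comp_apply, ContinuousMap.comp_apply, hψφ]
    rw [h2] at h1
    refine h1.congr fun n => ?_
    ext r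
    have h0 : x.1 (t n 0) = 0 := x.2 _ (ht0 n)
    simp only [Function.comp_apply, ContinuousMap.comp_apply, bernsteinApproximation.apply,
      ContinuousMap.sum_apply]
    refine Finset.sum_congr rfl fun k _ => ?_
    change _ = (x.1 (t n k) - x.1 (t n 0)) * β n k r
    rw [h0, sub_zero, hβ, Complex.real_smul, mul_comm]

namespace IsComplexWienerMeasure

variable {μ : Measure (PathSpace T)}

lemma isProbabilityMeasure (hμ : IsComplexWienerMeasure T μ) : IsProbabilityMeasure μ :=
  hμ.isGaussianProcess.isProbabilityMeasure

lemma isGaussian_map_pathEval (hμ : IsComplexWienerMeasure T μ)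
    (I : Finset (Set.Icc (0 : ℝ) T)) : IsGaussian (μ.map (pathEval I)) :=
  (hμ.isGaussianProcess.hasGaussianLaw I).isGaussian_map

lemma integral_map_pathEval (hμ : IsComplexWienerMeasure T μ) (I : Finset (Set.Icc (0 : ℝ) T)) :
    ∫ v, v ∂(μ.map (pathEval I)) = 0 := by
  have := hμ.isGaussian_map_pathEval I
  have hi : Integrable (fun v : I → ℂ => v) (μ.map (pathEval I)) := IsGaussian.integrable_id
  ext i
  rw [eval_integral fun j => hi.eval j, integral_map (pathEval I).continuous.measurable.aemeasurable
    (Continuous.aestronglyMeasurable (by fun_prop))]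
  exact hμ.mean_eq_zero i

/-- Rotation invariance of the finite-dimensional laws suffices, because evaluations at finitely
many times determine the measure. -/
lemma measurePreserving_smul (hT : 0 < T) (hμ : IsComplexWienerMeasure T μ) {c : ℂ}
    (hc : ‖c‖ = 1) : MeasurePreserving (fun x : PathSpace T => c • x) μ μ := by
  have hP := hμ.isProbabilityMeasure
  obtain ⟨I, s, hs, hlim⟩ := exists_tendsto_comp_pathEval hT
  have hm : Measurable (fun x : PathSpace T => c • x) := (continuous_const_smul c).measurable
  have : IsProbabilityMeasure (μ.map (fun x : PathSpace T => c • x)) :=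
    Measure.isProbabilityMeasure_map hm.aemeasurable
  refine ⟨hm, Measure.ext_of_tendsto_comp hs hlim fun n => ?_⟩
  have hπ : Measurable (pathEval (I n)) := (pathEval (I n)).continuous.measurable
  rw [Measure.map_map hπ hm]
  have h := map_smul_eq_of_planar (K := fun s t : Set.Icc (0 : ℝ) T => min (s : ℝ) t)
    hμ.isGaussianProcess hμ.mean_eq_zero hμ.cov_re_re hμ.cov_im_im hμ.cov_re_im (I n) hc
  refine Eq.trans ?_ h
  exact (Measure.map_map (measurable_const_smul c) hπ).symm

/-- **Nelson's hypercontractivity** for the symmetric Ornstein–Uhlenbeck operators on the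
path space. -/
lemma memLp_and_eLpNorm_le (hT : 0 < T) (hμ : IsComplexWienerMeasure T μ) {ρ σ p q : ℝ}
    (h : ρ ^ 2 + σ ^ 2 = 1) (hp : 1 < p) (hq : 1 < q) (hρ : ρ ^ 2 * (q - 1) ≤ p - 1)
    {F : PathSpace T → ℂ} (hF : MemLp F (ENNReal.ofReal p) μ) :
    (∀ᵐ x ∂μ, Integrable (fun y => F (ρ • x + σ • y)) μ) ∧
      MemLp (fun x => ∫ y, F (ρ • x + σ • y) ∂μ) (ENNReal.ofReal q) μ ∧
      eLpNorm (fun x => ∫ y, F (ρ • x + σ • y) ∂μ) (ENNReal.ofReal q) μ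
        ≤ eLpNorm F (ENNReal.ofReal p) μ := by
  have hP := hμ.isProbabilityMeasure
  obtain ⟨I, s, hs, hlim⟩ := exists_tendsto_comp_pathEval hT
  exact memLp_and_eLpNorm_le_of_tendsto_comp (V := fun n => I n → ℂ)
    (π := fun n => pathEval (I n)) (s := s) hs hlim
    (fun n => hμ.isGaussian_map_pathEval (I n)) (fun n => hμ.integral_map_pathEval (I n))
    h hp hq hρ hF

end IsComplexWienerMeasure

/-- Polar decomposition of the complex factor: a real contraction times a rotation that acts on `x`
alone. -/
lemma ouPoint_eq (θ t : ℝ) (x y : PathSpace T) :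
    ouPoint θ t x y = Real.exp (-(t * Real.cos θ)) •
      (Complex.exp ((-(t * Real.sin θ) : ℝ) * Complex.I) • x)
      + Real.sqrt (1 - Real.exp (-2 * t * Real.cos θ)) • y := by
  have h : Complex.exp (-((Real.cos θ : ℂ) + Complex.I * (Real.sin θ : ℂ)) * (t : ℂ))
      = ((Real.exp (-(t * Real.cos θ)) : ℝ) : ℂ)
        * Complex.exp ((-(t * Real.sin θ) : ℝ) * Complex.I) := by
    rw [Complex.ofReal_exp, ← Complex.exp_add]
    congr 1
    push_cast
    ring
  rw [ouPoint, h, mul_smul]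
  rfl

end PathSpace

/-! ### Reduction of the nonsymmetric semigroup to the symmetric one -/

theorem mainTheorem3 (T : ℝ) (hT : 0 < T) (μ : Measure (PathSpace T))
    (hμ : IsComplexWienerMeasure T μ)
    (θ : ℝ) (hθ : θ ∈ Set.Ioo (-(Real.pi / 2)) (Real.pi / 2))
    (t : ℝ) (ht : 0 ≤ t) (p : ℝ) (hp : 1 < p) (q : ℝ)
    (hq : q = Real.exp (2 * t * Real.cos θ) * (p - 1) + 1)
    (F : PathSpace T → ℂ) (hF : MemLp F (ENNReal.ofReal p) μ) :
    (∀ᵐ x ∂μ, Integrable (fun y => F (ouPoint θ t x y)) μ) ∧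
      MemLp (ouSemigroup μ θ t F) (ENNReal.ofReal q) μ ∧
      eLpNorm (ouSemigroup μ θ t F) (ENNReal.ofReal q) μ ≤ eLpNorm F (ENNReal.ofReal p) μ := by
  have hcos : 0 < Real.cos θ := Real.cos_pos_of_mem_Ioo hθ
  have hρ2 : Real.exp (-(t * Real.cos θ)) ^ 2 = Real.exp (-2 * t * Real.cos θ) := by
    rw [← Real.exp_nat_mul]; congr 1; push_cast; ring
  have hle : Real.exp (-2 * t * Real.cos θ) ≤ 1 := Real.exp_le_one_iff.2 (by
    have := mul_nonneg ht hcos.le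
    linarith)
  have h : Real.exp (-(t * Real.cos θ)) ^ 2 + Real.sqrt (1 - Real.exp (-2 * t * Real.cos θ)) ^ 2
      = 1 := by
    rw [Real.sq_sqrt (sub_nonneg.2 hle), hρ2]; ring
  have hq1 : 1 < q := by
    have := mul_pos (Real.exp_pos (2 * t * Real.cos θ)) (sub_pos.2 hp)
    linarith
  -- Equality holds here: `q` is the largest exponent that Nelson's condition allows.
  have hρq : Real.exp (-(t * Real.cos θ)) ^ 2 * (q - 1) ≤ p - 1 := by
    rw [hρ2, hq, add_sub_cancel_right, ← mul_assoc, ← Real.exp_add,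
      show -2 * t * Real.cos θ + 2 * t * Real.cos θ = 0 by ring, Real.exp_zero, one_mul]
  obtain ⟨h1, h2, h3⟩ := hμ.memLp_and_eLpNorm_le hT h hp hq1 hρq hF
  have hR := hμ.measurePreserving_smul hT (Complex.norm_exp_ofReal_mul_I (-(t * Real.sin θ)))
  have hcomp : ouSemigroup μ θ t F = (fun x => ∫ y, F (Real.exp (-(t * Real.cos θ)) • x
      + Real.sqrt (1 - Real.exp (-2 * t * Real.cos θ)) • y) ∂μ)
      ∘ (fun x => Complex.exp ((-(t * Real.sin θ) : ℝ) * Complex.I) • x) := by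
    ext x
    simp only [ouSemigroup, ouPoint_eq, Function.comp_apply]
  refine ⟨?_, ?_, ?_⟩
  · simp only [ouPoint_eq]
    exact hR.quasiMeasurePreserving.ae h1
  · rw [hcomp]
    exact h2.comp_measurePreserving hR
  · rw [hcomp, eLpNorm_comp_measurePreserving h2.1 hR]
    exact h3
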